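/- Work in the complex space $L^2=L^2(0,1)$, and let $T>0$. Let $a,b\in L^\infty(0,1)$ be real and non-negative, let $q\in L^\infty(0,1)$ be real, let $u_0\in L^2$ be such that its second distributional derivative $u_0''$ belongs to $L^2$ and $u_0(0)=u_0(1)=0$ (for the continuous representative), and let $u_1\in L^2$. Let $\mathcal L=-\frac{d^2}{dx^2}+q$ be the Sturm–Liouville operator in $L^2$ whose domain consists of the $f\in L^2$ with $f''\in L^2$ and $f(0)=f(1)=0$. For $s\ge 0$ the fractional power $\mathcal L^{s}$ is defined by $\mathcal L^{s}\phi=\lambda^{s}\phi$ for each eigenfunction $\phi$ of $\mathcal L$ with eigenvalue $\lambda$ (principal complex power), that is, $\mathcal L^s f=g$ means $\langle \phi,g\rangle=\lambda^s\langle\phi,f\rangle$ for all eigenpairs $(\lambda,\phi)$; and $W^1_{\mathcal L}=\{f\in L^2:\ \mathcal L^{1/2}f\in L^2\}$ with $\|f\|_{W^1_{\mathcal L}}=\|\mathcal L^{1/2}f\|_{L^2}$. (If $0$ is an eigenvalue, this is only a seminorm, and continuity into $W^1_{\mathcal L}$ includes continuity into $L^2$.) Consider the problem $$ \begin{cases}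 u_{tt}(t,x)-u_{xx}(t,x)+q(x)u(t,x)+a(x)u(t,x)+b(x)u_t(t,x)=0, & (t,x)\in[0,T]\times(0,1),\\ u(0,x)=u_0(x),\quad u_t(0,x)=u_1(x), & x\in(0,1),\\ u(t,0)=u(t,1)=0, & t\in[0,T], \end{cases} $$ where the equation means that for every $\psi$ in the domain of $\mathcal L$ and every $t\in[0,T]$ (one-sided at the end points) $$\frac{d}{dt}\langle \psi,u_t(t)\rangle+\langle\mathcal L\psi,u(t)\rangle+\langle\psi,a\,u(t)+b\,u_t(t)\rangle=0 .$$ (1) The problem has a unique solution $u\in C([0,T];W^1_{\mathcal L})\cap C^1([0,T];L^2)$. (2) For every $m\in\mathbb R$ there is a constant $C>0$, depending only on $T$ and $m$, such that whenever all eigenvalues of $\mathcal L$ are $\ge m$, the solution satisfies, for all $t\in[0,T]$, $$ \max\big\{\|u(t,\cdot)\|_{L^2},\ \|\mathcal L^{1/2}u(t,\cdot)\|_{L^2},\ \|u_t(t,\cdot)\|_{L^2}\big\}\le C\,(1+\|q\|_{L^\infty})(1+\|a\|_{L^\infty})(1+\|b\|_{L^\infty})\big[\|u_0\|_{L^2}+\|u_0''\|_{L^2}+\|u_1\|_{L^2}\big].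 $$ In particular, $C$ is independent of $q,a,b,u_0,u_1$ as long as the eigenvalues of $\mathcal L$ are all greater than $1$. -/

import Mathlib

open Set Filter Topology MeasureTheory
open scoped ENNReal ContDiff

namespace SturmLiouville

/-- Lebesgue measure on the interval `(0,1)`. -/
noncomputable abbrev intervalMeasure : Measure ℝ := volume.restrict (Ioo (0 : ℝ) 1)

/-- The complex Hilbert space `L²(0,1)`. -/
abbrev L2 : Type := Lp ℂ 2 intervalMeasure

/-- The space of real coefficients `L^∞(0,1)`, with the essential supremum norm. For `q : LInf`
and `f : L2`, Mathlib's `q • f : L2` is the pointwise product. -/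
abbrev LInf : Type := Lp ℝ ∞ intervalMeasure

/-- `h ∈ L²(0,1)` is the second distributional derivative on `(0,1)` of `f ∈ L²(0,1)`. -/
def HasWeakSecondDeriv (f h : L2) : Prop :=
  ∀ φ : ℝ → ℝ, ContDiff ℝ ∞ φ → HasCompactSupport φ → tsupport φ ⊆ Ioo (0 : ℝ) 1 →
    ∫ x in Ioo (0 : ℝ) 1, iteratedDeriv 2 φ x • f x = ∫ x in Ioo (0 : ℝ) 1, φ x • h x

/-- The Dirichlet condition `f(0) = f(1) = 0`: the class `f` has a representative that is
continuous on `[0,1]` and vanishes at both end points. -/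
def VanishesAtEndpoints (f : L2) : Prop :=
  ∃ F : ℝ → ℂ, ContinuousOn F (Icc 0 1) ∧ f =ᵐ[intervalMeasure] F ∧ F 0 = 0 ∧ F 1 = 0

/-- The graph of the Dirichlet Sturm-Liouville operator `𝓛 = -d²/dx² + q` in `L²(0,1)`:
`f` lies in the domain of `𝓛`, and `𝓛 f = g`. -/
def IsSturmLiouville (q : LInf) (f g : L2) : Prop :=
  VanishesAtEndpoints f ∧ ∃ h : L2, HasWeakSecondDeriv f h ∧ g = -h + q • f

/-- `φ` is an eigenfunction of `𝓛` for the eigenvalue `l`. The operator is self-adjoint, so that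
all its eigenvalues are real. -/
def IsEigenpair (q : LInf) (l : ℝ) (φ : L2) : Prop :=
  φ ≠ 0 ∧ IsSturmLiouville q φ ((l : ℂ) • φ)

/-- The graph of the fractional power `𝓛^s`: the operator acts on every eigenfunction of
eigenvalue `l` as multiplication by `l^s`. That is, `𝓛^s f = g` when each Fourier coefficient of
`g` is `l^s` times that of `f`. The power is the principal complex power, as finitely many
eigenvalues can be negative. -/
def IsFractionalPower (q : LInf) (s : ℝ) (f g : L2) : Prop :=
  ∀ (l : ℝ) (φ : L2), IsEigenpair q l φ →
    inner ℂ φ g = (l : ℂ) ^ (s : ℂ) * inner ℂ φ f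

/-- `u ∈ C([0,T]; W^s_𝓛(0,1))`, where `W^s_𝓛(0,1)`, for `s ≥ 0`, consists of the `f ∈ L²(0,1)` with
`𝓛^{s/2} f ∈ L²(0,1)` and has the norm `‖𝓛^{s/2} f‖`. -/
def IsContinuousIntoSobolev (T : ℝ) (q : LInf) (s : ℝ) (u : ℝ → L2) : Prop :=
  ContinuousOn u (Icc 0 T) ∧
    ∃ w : ℝ → L2, (∀ t ∈ Icc 0 T, IsFractionalPower q (s / 2) (u t) (w t)) ∧
      ContinuousOn w (Icc 0 T)

/-- The time derivative `u_t` on `[0,T]`, one-sided at the end points. -/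
noncomputable def timeDeriv (T : ℝ) (u : ℝ → L2) (t : ℝ) : L2 := derivWithin u (Icc 0 T) t

/-- `u_tt + 𝓛 u + a u + b u_t = 0` on `[0,T] × (0,1)`, tested in space against the
functions `ψ` in the domain of `𝓛`. -/
def SatisfiesWaveEquation (T : ℝ) (q a b : LInf) (u : ℝ → L2) : Prop :=
  ∀ ψ Lψ : L2, IsSturmLiouville q ψ Lψ → ∀ t ∈ Icc 0 T,
    HasDerivWithinAt (fun τ => inner ℂ ψ (timeDeriv T u τ))
      (-(inner ℂ Lψ (u t) + inner ℂ ψ (a • u t) + inner ℂ ψ (b • timeDeriv T u t)))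
      (Icc 0 T) t

/-- `u ∈ C([0,T]; W^1_𝓛(0,1)) ∩ C^1([0,T]; L²(0,1))` solves the initial/boundary problem
`u_tt + 𝓛 u + a u + b u_t = 0`, `u(0,·) = u₀`, `u_t(0,·) = u₁`, `u(t,0) = u(t,1) = 0`. -/
structure IsSolution (T : ℝ) (q a b : LInf) (u₀ u₁ : L2) (u : ℝ → L2) : Prop where
  continuous_sobolev : IsContinuousIntoSobolev T q 1 u
  contDiff : ContDiffOn ℝ 1 u (Icc 0 T)
  equation : SatisfiesWaveEquation T q a b u
  initial : u 0 = u₀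
  initial_deriv : timeDeriv T u 0 = u₁
  boundary : ∀ t ∈ Icc 0 T, VanishesAtEndpoints (u t)

end SturmLiouville

/-!
The Green operator of `-d²/dx²` with Dirichlet conditions factors as `B B†`, where `B` is the
primitive operator `g ↦ ∫_0^x g` precomposed with the projection onto the functions of mean zero.
Since `B` is compact, so is a resolvent of `𝓛 = -d²/dx² + q`, and `L²(0,1)` has a Hilbert basis of
eigenfunctions of `𝓛`.

Choose `M` with `1 ≤ 𝓛 + M` and put `p = (𝓛 + M)^{1/2} u`, `r = u_t`. In the eigenbasis the wave
equation is the first-order system `p' = ν r`, `r' = -ν p + M u - a u - b r` with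
`ν = (𝓛 + M)^{1/2}`. Rotating the pair `(p, r)` by the angle `-ν t` removes the unbounded
multiplier: the new unknown solves an ordinary differential equation with a Lipschitz right-hand
side, which gives existence, and is differentiable in norm. Hence the energy
`‖p‖² + ‖r‖² + ⟨u, a u⟩` is differentiable, with derivative `2 Re (M ⟨r, u⟩ - ⟨r, b r⟩)`. As
`a, b ≥ 0` this is at most `M` times the energy, and Gronwall's inequality gives the estimate, and
uniqueness.
-/

namespace SturmLiouville

/-! ### The primitive operator -/

section Compactness

variable {𝕜 H E : Type*} [RCLike 𝕜] [NormedAddCommGroup H] [InnerProductSpace 𝕜 H]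
  [NormedAddCommGroup E] [NormedSpace 𝕜 E] [CompleteSpace E]

lemma isCompactOperator_of_norm_le_on_orthogonal {A : H →L[𝕜] E}
    (hA : ∀ ε > 0, ∃ F : Submodule 𝕜 H, FiniteDimensional 𝕜 F ∧ ∀ x ∈ Fᗮ, ‖A x‖ ≤ ε * ‖x‖) :
    IsCompactOperator A := by
  refine (isClosed_setOfPred_isCompactOperator (σ₁₂ := RingHom.id 𝕜)).closure_subset
    (Metric.mem_closure_iff.2 fun ε hε => ?_)
  obtain ⟨F, hF, hAF⟩ := hA (ε / 2) (half_pos hε)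
  have hproj : IsCompactOperator F.orthogonalProjectionOnto :=
    isCompactOperator_of_locallyCompactSpace_dom _
  refine ⟨A ∘L F.starProjection, (hproj.clm_comp F.subtypeL).clm_comp A, ?_⟩
  rw [dist_eq_norm]
  refine (ContinuousLinearMap.opNorm_le_bound _ (half_pos hε).le fun x => ?_).trans_lt
    (half_lt_self hε)
  calc ‖(A - A ∘L F.starProjection) x‖ = ‖A (Fᗮ.starProjection x)‖ := by
        simp [Submodule.starProjection_orthogonal_val]
    _ ≤ ε / 2 * ‖Fᗮ.starProjection x‖ := hAF _ (Submodule.starProjection_apply_mem _ _)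
    _ ≤ ε / 2 * ‖x‖ := by gcongr; exact Submodule.norm_starProjection_apply_le _ _

end Compactness

instance isProbabilityMeasure_intervalMeasure : IsProbabilityMeasure intervalMeasure :=
  ⟨by simp [intervalMeasure]⟩

lemma norm_le_of_forall_ae_norm_le {α E : Type*} [MeasurableSpace α] {μ : Measure α}
    [IsProbabilityMeasure μ] [NormedAddCommGroup E] {p : ℝ≥0∞} {f : Lp E p μ} {C : ℝ}
    (hC : 0 ≤ C) (hf : ∀ᵐ x ∂μ, ‖f x‖ ≤ C) : ‖f‖ ≤ C := by
  simpa [measureUnivNNReal] using Lp.norm_le_of_ae_bound hC hf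

/-- The class in `L²(0,1)` of the indicator function of `(0,x)`. The inner product with it is the
value at `x` of the primitive. -/
noncomputable def initialIndicator (x : ℝ) : L2 :=
  indicatorConstLp 2 (measurableSet_Iio (a := x)) (measure_ne_top intervalMeasure _) (1 : ℂ)

lemma norm_initialIndicator_le (x : ℝ) : ‖initialIndicator x‖ ≤ 1 := by
  rw [initialIndicator, norm_indicatorConstLp (by simp) (by simp), norm_one, one_mul]
  exact Real.rpow_le_one measureReal_nonneg measureReal_le_one (by positivity)

lemma initialIndicator_zero : initialIndicator 0 = 0 := by
  rw [initialIndicator, ← norm_eq_zero, norm_indicatorConstLp (by simp) (by simp)]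
  simp [Measure.real, Measure.restrict_apply measurableSet_Iio, Iio_inter_Ioo]

lemma dist_initialIndicator_le (x y : ℝ) :
    dist (initialIndicator x) (initialIndicator y) ≤ √|x - y| := by
  have hsub : symmDiff (Iio x) (Iio y) ⊆ uIcc x y := by
    rintro z (⟨hzx, hzy⟩ | ⟨hzy, hzx⟩) <;> rw [mem_uIcc] <;> simp only [mem_Iio] at * <;> grind
  have hmeas : intervalMeasure.real (symmDiff (Iio x) (Iio y)) ≤ |x - y| :=
    calc intervalMeasure.real (symmDiff (Iio x) (Iio y)) ≤ volume.real (uIcc x y) :=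
          ENNReal.toReal_mono (by simp [uIcc])
            ((Measure.restrict_apply_le _ _).trans (measure_mono hsub))
      _ = |x - y| := by simp [Measure.real, Real.volume_interval, abs_sub_comm]
  rw [initialIndicator, initialIndicator, dist_indicatorConstLp_eq_norm,
    norm_indicatorConstLp (by simp) (by simp), Real.sqrt_eq_rpow]
  simpa using Real.rpow_le_rpow measureReal_nonneg hmeas (by norm_num : (0 : ℝ) ≤ 2⁻¹)

lemma continuous_initialIndicator : Continuous initialIndicator := by
  refine continuous_iff_continuousAt.2 fun x => tendsto_iff_dist_tendsto_zero.2 ?_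
  refine squeeze_zero (fun _ => dist_nonneg) (fun y => dist_initialIndicator_le y x) ?_
  have hsqrt : Continuous fun y : ℝ => √|y - x| := by fun_prop
  simpa using hsqrt.tendsto x

/-- The primitive `x ↦ ∫_0^x f` of `f ∈ L²(0,1)`. -/
noncomputable def primitive (f : L2) (x : ℝ) : ℂ := ∫ y in Iio x, f y ∂intervalMeasure

lemma inner_initialIndicator (x : ℝ) (f : L2) :
    inner ℂ (initialIndicator x) f = primitive f x :=
  L2.inner_indicatorConstLp_one _ _ f

lemma primitive_zero_right (f : L2) : primitive f 0 = 0 := by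
  rw [← inner_initialIndicator, initialIndicator_zero, inner_zero_left]

lemma continuous_primitive (f : L2) : Continuous (primitive f) :=
  (continuous_initialIndicator.inner continuous_const).congr fun x => inner_initialIndicator x f

lemma norm_primitive_le (f : L2) (x : ℝ) : ‖primitive f x‖ ≤ ‖f‖ := by
  rw [← inner_initialIndicator]
  exact (norm_inner_le_norm _ _).trans
    (mul_le_of_le_one_left (norm_nonneg _) (norm_initialIndicator_le x))

lemma memLp_primitive (f : L2) : MemLp (primitive f) 2 intervalMeasure :=
  MemLp.of_bound (continuous_primitive f).aestronglyMeasurable ‖f‖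
    (ae_of_all _ (norm_primitive_le f))

/-- The operator on `L²(0,1)` that maps `f` to its primitive `x ↦ ∫_0^x f`. -/
noncomputable def primitiveL : L2 →L[ℂ] L2 :=
  LinearMap.mkContinuous
    { toFun := fun f => (memLp_primitive f).toLp
      map_add' := fun f g => by
        rw [← MemLp.toLp_add]
        congr 1
        ext x
        simp only [← inner_initialIndicator, inner_add_right, Pi.add_apply]
      map_smul' := fun c f => by
        rw [RingHom.id_apply, ← MemLp.toLp_const_smul]
        congr 1
        ext x
        simp only [← inner_initialIndicator, inner_smul_right, Pi.smul_apply, smul_eq_mul] }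
    1 fun f => by
      rw [one_mul]
      refine norm_le_of_forall_ae_norm_le (norm_nonneg _) ?_
      filter_upwards [(memLp_primitive f).coeFn_toLp] with x hx
      exact hx ▸ norm_primitive_le f x

lemma coeFn_primitiveL (f : L2) : primitiveL f =ᵐ[intervalMeasure] primitive f :=
  (memLp_primitive f).coeFn_toLp

/-- The indicators of `(0,x)` form a compact set, so that up to `ε` the primitive only depends on
the inner products with finitely many of them. -/
lemma isCompactOperator_primitiveL : IsCompactOperator primitiveL := by
  refine isCompactOperator_of_norm_le_on_orthogonal fun ε hε => ?_
  obtain ⟨t, -, htf, ht⟩ := ((isCompact_Icc (a := (0 : ℝ)) (b := 1)).image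
    continuous_initialIndicator).finite_cover_balls hε
  refine ⟨Submodule.span ℂ t, FiniteDimensional.span_of_finite ℂ htf, fun f hf => ?_⟩
  refine norm_le_of_forall_ae_norm_le (by positivity) ?_
  filter_upwards [coeFn_primitiveL f, ae_restrict_mem measurableSet_Ioo] with x hx hx01
  obtain ⟨e, het, hxe⟩ := mem_iUnion₂.1 (ht ⟨x, Ioo_subset_Icc_self hx01, rfl⟩)
  have hef : inner ℂ e f = 0 := hf e (Submodule.subset_span het)
  calc ‖primitiveL f x‖ = ‖inner ℂ (initialIndicator x - e) f‖ := by
        rw [hx, inner_sub_left, hef, sub_zero, inner_initialIndicator]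
    _ ≤ ‖initialIndicator x - e‖ * ‖f‖ := norm_inner_le_norm _ _
    _ ≤ ε * ‖f‖ := by
        rw [← dist_eq_norm]
        gcongr
        exact (Metric.mem_ball.1 hxe).le

/-- The operator `B` that maps `f` to the primitive of `f - ∫ f`. Its range is `H¹₀(0,1)`, and
`B B†` is the inverse of the Dirichlet Laplacian. -/
noncomputable def dirichletPrimitive : L2 →L[ℂ] L2 :=
  primitiveL ∘L (ℂ ∙ initialIndicator 1)ᗮ.starProjection

lemma isCompactOperator_dirichletPrimitive : IsCompactOperator dirichletPrimitive :=
  isCompactOperator_primitiveL.comp_clm _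

lemma vanishesAtEndpoints_dirichletPrimitive (f : L2) :
    VanishesAtEndpoints (dirichletPrimitive f) := by
  set g := (ℂ ∙ initialIndicator 1)ᗮ.starProjection f
  have horth : inner ℂ (initialIndicator 1) g = 0 :=
    Submodule.mem_orthogonal_singleton_iff_inner_right.1 (Submodule.starProjection_apply_mem _ f)
  exact ⟨primitive g, (continuous_primitive g).continuousOn, coeFn_primitiveL g,
    primitive_zero_right g, by rw [← inner_initialIndicator, horth]⟩

/-! ### Test functions and weak derivatives -/

lemma integral_mul_setIntegral_Iio {𝕜 : Type*} [RCLike 𝕜] {μ : Measure ℝ} [SFinite μ]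
    {f g : ℝ → 𝕜} (hf : Integrable f μ) (hg : Integrable g μ) :
    ∫ x, g x * ∫ y in Iio x, f y ∂μ ∂μ = ∫ y, (∫ x in Ioi y, g x ∂μ) * f y ∂μ := by
  have hint : Integrable (Function.uncurry fun x y => (Iio x).indicator (fun y => g x * f y) y)
      (μ.prod μ) := by
    have hmeas : MeasurableSet {z : ℝ × ℝ | z.2 < z.1} :=
      measurableSet_lt measurable_snd measurable_fst
    exact ((hg.mul_prod hf).indicator hmeas).congr (ae_of_all _ fun z => by
      simp [Function.uncurry, indicator])
  calc ∫ x, g x * ∫ y in Iio x, f y ∂μ ∂μ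
      = ∫ x, ∫ y, (Iio x).indicator (fun y => g x * f y) y ∂μ ∂μ := by
        simp only [integral_indicator measurableSet_Iio, integral_const_mul]
    _ = ∫ y, ∫ x, (Ioi y).indicator (fun x => g x * f y) x ∂μ ∂μ := by
        rw [integral_integral_swap hint]
        rfl
    _ = ∫ y, (∫ x in Ioi y, g x ∂μ) * f y ∂μ := by
        simp only [integral_indicator measurableSet_Ioi, integral_mul_const]

/-- The smooth functions with compact support in `(0,1)`. -/
structure IsTest (φ : ℝ → ℝ) : Prop where
  contDiff : ContDiff ℝ ∞ φ
  hasCompactSupport : HasCompactSupport φ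
  tsupport_subset : tsupport φ ⊆ Ioo (0 : ℝ) 1

namespace IsTest

variable {φ ψ : ℝ → ℝ}

protected lemma deriv (hφ : IsTest φ) : IsTest (deriv φ) :=
  ⟨hφ.contDiff.iterate_deriv 1, hφ.hasCompactSupport.deriv,
    tsupport_deriv_subset.trans hφ.tsupport_subset⟩

lemma sub (hφ : IsTest φ) (hψ : IsTest ψ) : IsTest (φ - ψ) :=
  ⟨hφ.contDiff.sub hψ.contDiff, hφ.hasCompactSupport.sub hψ.hasCompactSupport,
    (tsupport_sub φ ψ).trans (union_subset hφ.tsupport_subset hψ.tsupport_subset)⟩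

lemma const_smul (c : ℝ) (hφ : IsTest φ) : IsTest (c • φ) :=
  ⟨hφ.contDiff.const_smul c, hφ.hasCompactSupport.smul_left (f := fun _ => c),
    (tsupport_smul_subset_right (fun _ => c) φ).trans hφ.tsupport_subset⟩

lemma eq_zero_of_notMem (hφ : IsTest φ) {x : ℝ} (hx : x ∉ Ioo (0 : ℝ) 1) : φ x = 0 :=
  image_eq_zero_of_notMem_tsupport fun hx' => hx (hφ.tsupport_subset hx')

lemma hasDerivAt (hφ : IsTest φ) (x : ℝ) : HasDerivAt φ (deriv φ x) x :=
  (hφ.contDiff.differentiable (by simp)).differentiableAt.hasDerivAt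

lemma integrable (hφ : IsTest φ) : Integrable φ :=
  hφ.contDiff.continuous.integrable_of_hasCompactSupport hφ.hasCompactSupport

lemma integrable_smul {E : Type*} [NormedAddCommGroup E] [NormedSpace ℝ E] {k : ℝ → E}
    (hφ : IsTest φ) (hk : Integrable k intervalMeasure) :
    Integrable (fun x => φ x • k x) intervalMeasure := by
  obtain ⟨C, hC⟩ := hφ.hasCompactSupport.exists_bound_of_continuous hφ.contDiff.continuous
  exact hk.bdd_smul C hφ.contDiff.continuous.aestronglyMeasurable (ae_of_all _ hC)

lemma integral_smul_eq {E : Type*} [NormedAddCommGroup E] [NormedSpace ℝ E] (hφ : IsTest φ)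
    (k : ℝ → E) : ∫ x, φ x • k x ∂intervalMeasure = ∫ x, φ x • k x :=
  setIntegral_eq_integral_of_forall_compl_eq_zero fun x hx => by
    rw [hφ.eq_zero_of_notMem hx, zero_smul]

lemma setIntegral_eq (hφ : IsTest φ) {s : Set ℝ} (hs : MeasurableSet s) :
    ∫ x in s, φ x ∂intervalMeasure = ∫ x in s, φ x := by
  rw [Measure.restrict_restrict hs, inter_comm, ← Measure.restrict_restrict measurableSet_Ioo]
  exact setIntegral_eq_integral_of_forall_compl_eq_zero fun x hx => hφ.eq_zero_of_notMem hx

lemma setIntegral_Iio_deriv (hφ : IsTest φ) (x : ℝ) :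
    ∫ y in Iio x, deriv φ y ∂intervalMeasure = φ x := by
  rw [hφ.deriv.setIntegral_eq measurableSet_Iio, ← integral_Iic_eq_integral_Iio,
    hφ.hasCompactSupport.integral_Iic_deriv_eq (hφ.contDiff.of_le (by simp))]

lemma setIntegral_Ioi_deriv (hφ : IsTest φ) (x : ℝ) :
    ∫ y in Ioi x, deriv φ y ∂intervalMeasure = -φ x := by
  rw [hφ.deriv.setIntegral_eq measurableSet_Ioi,
    hφ.hasCompactSupport.integral_Ioi_deriv_eq (hφ.contDiff.of_le (by simp))]

lemma memLp (hφ : IsTest φ) : MemLp (fun x => (φ x : ℂ)) 2 intervalMeasure := by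
  obtain ⟨C, hC⟩ := hφ.hasCompactSupport.exists_bound_of_continuous hφ.contDiff.continuous
  exact MemLp.of_bound (Complex.continuous_ofReal.comp hφ.contDiff.continuous).aestronglyMeasurable
    C (ae_of_all _ fun x => by simpa using hC x)

/-- The class of a test function in `L²(0,1)`. -/
noncomputable def toL2 (hφ : IsTest φ) : L2 := hφ.memLp.toLp

lemma coeFn_toL2 (hφ : IsTest φ) : hφ.toL2 =ᵐ[intervalMeasure] fun x => (φ x : ℂ) :=
  hφ.memLp.coeFn_toLp

lemma inner_toL2 (hφ : IsTest φ) (f : L2) :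
    inner ℂ hφ.toL2 f = ∫ x, φ x • f x ∂intervalMeasure := by
  rw [L2.inner_def]
  refine integral_congr_ae ?_
  filter_upwards [hφ.coeFn_toL2] with x hx
  simp [hx, RCLike.inner_apply, mul_comm]

lemma primitive_toL2_deriv (hφ : IsTest φ) (x : ℝ) : primitive hφ.deriv.toL2 x = φ x := by
  rw [primitive, integral_congr_ae (ae_restrict_of_ae hφ.deriv.coeFn_toL2),
    integral_complex_ofReal, hφ.setIntegral_Iio_deriv]

lemma primitiveL_toL2_deriv (hφ : IsTest φ) : primitiveL hφ.deriv.toL2 = hφ.toL2 := by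
  refine Lp.ext ?_
  filter_upwards [coeFn_primitiveL hφ.deriv.toL2, hφ.coeFn_toL2] with x hprim hx
  rw [hprim, hx, hφ.primitive_toL2_deriv]

end IsTest

lemma integrable_coeFn (f : L2) : Integrable f intervalMeasure :=
  (Lp.memLp f).integrable (by norm_num)

lemma IsTest.inner_toL2_deriv_primitiveL {φ : ℝ → ℝ} (hφ : IsTest φ) (f : L2) :
    inner ℂ hφ.deriv.toL2 (primitiveL f) = -inner ℂ hφ.toL2 f := by
  have hprim : ∀ᵐ x ∂intervalMeasure,
      deriv φ x • primitiveL f x = ((deriv φ x : ℝ) : ℂ) * ∫ y in Iio x, f y ∂intervalMeasure := by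
    filter_upwards [coeFn_primitiveL f] with x hx
    rw [hx, primitive, Complex.real_smul]
  rw [inner_toL2, inner_toL2, integral_congr_ae hprim,
    integral_mul_setIntegral_Iio (integrable_coeFn f)
      (g := fun x => ((deriv φ x : ℝ) : ℂ)) (hφ.deriv.integrable.ofReal.restrict), ← integral_neg]
  refine integral_congr_ae (ae_of_all _ fun x => ?_)
  simp only [integral_complex_ofReal, hφ.setIntegral_Ioi_deriv, Complex.ofReal_neg, neg_mul,
    Complex.real_smul]

lemma hasWeakSecondDeriv_iff {f h : L2} : HasWeakSecondDeriv f h ↔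
    ∀ (φ : ℝ → ℝ) (hφ : IsTest φ), inner ℂ hφ.deriv.deriv.toL2 f = inner ℂ hφ.toL2 h := by
  simp only [IsTest.inner_toL2, HasWeakSecondDeriv, iteratedDeriv_succ, iteratedDeriv_zero]
  exact ⟨fun H φ hφ => H φ hφ.contDiff hφ.hasCompactSupport hφ.tsupport_subset,
    fun H φ h₁ h₂ h₃ => H φ ⟨h₁, h₂, h₃⟩⟩

lemma HasWeakSecondDeriv.sub {f g h k : L2} (H : HasWeakSecondDeriv f h)
    (K : HasWeakSecondDeriv g k) : HasWeakSecondDeriv (f - g) (h - k) := by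
  rw [hasWeakSecondDeriv_iff] at *
  intro φ hφ
  rw [inner_sub_right, inner_sub_right, H φ hφ, K φ hφ]

lemma VanishesAtEndpoints.sub {f g : L2} (hf : VanishesAtEndpoints f)
    (hg : VanishesAtEndpoints g) : VanishesAtEndpoints (f - g) := by
  obtain ⟨F, hF, hfF, hF0, hF1⟩ := hf
  obtain ⟨G, hG, hgG, hG0, hG1⟩ := hg
  refine ⟨F - G, hF.sub hG, ?_, by simp [hF0, hG0], by simp [hF1, hG1]⟩
  filter_upwards [hfF, hgG, Lp.coeFn_sub f g] with x hxF hxG hx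
  rw [hx, Pi.sub_apply, Pi.sub_apply, hxF, hxG]

/-! ### The Green operator -/

/-- The Green operator `B B†` of the Dirichlet Laplacian: `f = green h` is the solution of
`-f'' = h` with `f(0) = f(1) = 0`. -/
noncomputable def green : L2 →L[ℂ] L2 :=
  dirichletPrimitive ∘L ContinuousLinearMap.adjoint dirichletPrimitive

lemma vanishesAtEndpoints_green (h : L2) : VanishesAtEndpoints (green h) :=
  vanishesAtEndpoints_dirichletPrimitive _

lemma inner_green_left (f g : L2) : inner ℂ (green f) g = inner ℂ f (green g) := by
  simp only [green, ContinuousLinearMap.comp_apply]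
  rw [← ContinuousLinearMap.adjoint_inner_right, ContinuousLinearMap.adjoint_inner_left]

namespace IsTest

variable {φ : ℝ → ℝ}

lemma starProjection_toL2_deriv (hφ : IsTest φ) :
    (ℂ ∙ initialIndicator 1)ᗮ.starProjection hφ.deriv.toL2 = hφ.deriv.toL2 := by
  rw [Submodule.starProjection_eq_self_iff, Submodule.mem_orthogonal_singleton_iff_inner_right,
    inner_initialIndicator, hφ.primitive_toL2_deriv, hφ.eq_zero_of_notMem (by simp),
    Complex.ofReal_zero]

lemma dirichletPrimitive_toL2_deriv (hφ : IsTest φ) :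
    dirichletPrimitive hφ.deriv.toL2 = hφ.toL2 := by
  rw [dirichletPrimitive, ContinuousLinearMap.comp_apply, hφ.starProjection_toL2_deriv,
    hφ.primitiveL_toL2_deriv]

lemma adjoint_dirichletPrimitive_toL2_deriv_deriv (hφ : IsTest φ) :
    ContinuousLinearMap.adjoint dirichletPrimitive hφ.deriv.deriv.toL2 = -hφ.deriv.toL2 := by
  refine ext_inner_right ℂ fun f => ?_
  rw [ContinuousLinearMap.adjoint_inner_left, dirichletPrimitive, ContinuousLinearMap.comp_apply,
    hφ.deriv.inner_toL2_deriv_primitiveL, ← Submodule.inner_starProjection_left_eq_right,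
    hφ.starProjection_toL2_deriv, inner_neg_left]

lemma green_toL2_deriv_deriv (hφ : IsTest φ) : green hφ.deriv.deriv.toL2 = -hφ.toL2 := by
  rw [green, ContinuousLinearMap.comp_apply, hφ.adjoint_dirichletPrimitive_toL2_deriv_deriv,
    map_neg, hφ.dirichletPrimitive_toL2_deriv]

end IsTest

lemma hasWeakSecondDeriv_green (h : L2) : HasWeakSecondDeriv (green h) (-h) :=
  hasWeakSecondDeriv_iff.2 fun φ hφ => by
    rw [← inner_green_left, hφ.green_toL2_deriv_deriv, inner_neg_left, inner_neg_right]

/-! ### The lemma of du Bois-Reymond -/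

namespace IsTest

variable {φ : ℝ → ℝ}

lemma exists_integral_eq_one : ∃ ρ, IsTest ρ ∧ ∫ x, ρ x = 1 := by
  let bump : ContDiffBump (1 / 2 : ℝ) := ⟨1 / 8, 1 / 4, by norm_num, by norm_num⟩
  refine ⟨bump.normed volume, ⟨bump.contDiff_normed, bump.hasCompactSupport_normed, ?_⟩,
    bump.integral_normed⟩
  rw [bump.tsupport_normed_eq, Real.closedBall_eq_Icc]
  exact Icc_subset_Ioo (by norm_num [bump]) (by norm_num [bump])

lemma exists_tsupport_subset_Icc (hφ : IsTest φ) :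
    ∃ c d, 0 < c ∧ d < 1 ∧ tsupport φ ⊆ Icc c d := by
  rcases (tsupport φ).eq_empty_or_nonempty with hempty | hne
  · exact ⟨1, 0, by norm_num, by norm_num, by simp [hempty]⟩
  · have hK : IsCompact (tsupport φ) := hφ.hasCompactSupport
    exact ⟨sInf (tsupport φ), sSup (tsupport φ), (hφ.tsupport_subset (hK.sInf_mem hne)).1,
      (hφ.tsupport_subset (hK.sSup_mem hne)).2, subset_Icc_csInf_csSup hK.bddBelow hK.bddAbove⟩

lemma hasDerivAt_setIntegral_Iic (hφ : IsTest φ) (x : ℝ) :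
    HasDerivAt (fun x => ∫ y in Iic x, φ y) (φ x) x := by
  have hcont := hφ.contDiff.continuous
  have hbase : (fun x => ∫ y in Iic x, φ y) = fun x => (∫ y in (0 : ℝ)..x, φ y) +
      ∫ y in Iic 0, φ y := funext fun x => by
    rw [← intervalIntegral.integral_Iic_sub_Iic hφ.integrable.integrableOn
      hφ.integrable.integrableOn, sub_add_cancel]
  rw [hbase]
  exact (intervalIntegral.integral_hasDerivAt_right (hcont.intervalIntegrable _ _)
    (hcont.stronglyMeasurableAtFilter _ _) hcont.continuousAt).add_const _

lemma exists_deriv_eq (hφ : IsTest φ) (hint : ∫ x, φ x = 0) : ∃ ψ, IsTest ψ ∧ deriv ψ = φ := by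
  obtain ⟨c, d, hc, hd, hcd⟩ := hφ.exists_tsupport_subset_Icc
  have hzero (x : ℝ) (hx : x ∉ Icc c d) : φ x = 0 :=
    image_eq_zero_of_notMem_tsupport fun hx' => hx (hcd hx')
  set ψ : ℝ → ℝ := fun x => ∫ y in Iic x, φ y
  have hderiv : deriv ψ = φ := funext fun x => (hφ.hasDerivAt_setIntegral_Iic x).deriv
  have hleft (x : ℝ) (hx : x < c) : ψ x = 0 :=
    setIntegral_eq_zero_of_forall_eq_zero fun y hy =>
      hzero y fun hy' => (hy'.1.trans hy).not_gt hx
  have hright (x : ℝ) (hx : d < x) : ψ x = 0 := by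
    rw [← hint]
    exact setIntegral_eq_integral_of_forall_compl_eq_zero fun y hy =>
      hzero y fun hy' => hy (hy'.2.trans hx.le)
  have hsupp : tsupport ψ ⊆ Icc c d := closure_minimal (fun x hx => by
    by_contra! hxcd
    rcases lt_or_ge x c with hxc | hcx
    · exact hx (hleft x hxc)
    · exact hx (hright x (not_le.1 fun hxd => hxcd ⟨hcx, hxd⟩))) isClosed_Icc
  refine ⟨ψ, ⟨?_, isCompact_Icc.of_isClosed_subset (isClosed_tsupport _) hsupp,
    hsupp.trans (Icc_subset_Ioo hc hd)⟩, hderiv⟩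
  exact contDiff_infty_iff_deriv.2
    ⟨fun x => (hφ.hasDerivAt_setIntegral_Iic x).differentiableAt, hderiv ▸ hφ.contDiff⟩

lemma exists_deriv_eq_sub (hφ : IsTest φ) {ρ : ℝ → ℝ} (hρ : IsTest ρ) (hρ1 : ∫ x, ρ x = 1) :
    ∃ ψ, IsTest ψ ∧ deriv ψ = φ - (∫ x, φ x) • ρ := by
  refine (hφ.sub (hρ.const_smul _)).exists_deriv_eq ?_
  rw [integral_sub' hφ.integrable (hρ.integrable.smul _)]
  simp [integral_const_mul, hρ1]

lemma integral_mul_deriv (hφ : IsTest φ) : ∫ x, x * deriv φ x = -∫ x, φ x := by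
  have hint {g : ℝ → ℝ} (hg : IsTest g) : Integrable fun x => x * g x :=
    (continuous_id.mul hg.contDiff.continuous).integrable_of_hasCompactSupport
      hg.hasCompactSupport.mul_left
  simpa using integral_mul_deriv_eq_deriv_mul_of_integrable (u := id) (u' := 1)
    (fun x _ => hasDerivAt_id x) (fun x _ => hφ.hasDerivAt x) (hint hφ.deriv)
    (by simpa using hφ.integrable) (hint hφ)

end IsTest

section Weak

variable {E : Type*} [NormedAddCommGroup E] [NormedSpace ℝ E] {k : ℝ → E}

lemma ae_eq_zero_of_forall_isTest [CompleteSpace E] (hk : Integrable k intervalMeasure)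
    (h : ∀ φ, IsTest φ → ∫ x, φ x • k x ∂intervalMeasure = 0) : k =ᵐ[intervalMeasure] 0 := by
  refine (ae_restrict_iff' measurableSet_Ioo).2
    (isOpen_Ioo.ae_eq_zero_of_integral_contDiff_smul_eq_zero
      (IntegrableOn.locallyIntegrableOn hk) fun φ h₁ h₂ h₃ => ?_)
  rw [← IsTest.integral_smul_eq ⟨h₁, h₂, h₃⟩]
  exact h φ ⟨h₁, h₂, h₃⟩

lemma IsTest.integral_sub_smul_smul {φ ρ : ℝ → ℝ} (hφ : IsTest φ) (hρ : IsTest ρ) (c : ℝ)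
    (hk : Integrable k intervalMeasure) :
    ∫ x, (φ - c • ρ) x • k x ∂intervalMeasure =
      ∫ x, φ x • k x ∂intervalMeasure - c • ∫ x, ρ x • k x ∂intervalMeasure := by
  simp only [Pi.sub_apply, Pi.smul_apply, sub_smul, smul_assoc]
  rw [← integral_smul]
  exact integral_sub (hφ.integrable_smul hk) ((hρ.integrable_smul hk).smul c)

lemma exists_ae_eq_const_of_integral_deriv_smul_eq_zero [CompleteSpace E]
    (hk : Integrable k intervalMeasure)
    (h : ∀ φ, IsTest φ → ∫ x, deriv φ x • k x ∂intervalMeasure = 0) :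
    ∃ c : E, k =ᵐ[intervalMeasure] fun _ => c := by
  obtain ⟨ρ, hρ, hρ1⟩ := IsTest.exists_integral_eq_one
  set c := ∫ x, ρ x • k x ∂intervalMeasure with hc
  suffices hzero : (fun x => k x - c) =ᵐ[intervalMeasure] 0 from
    ⟨c, hzero.mono fun x hx => sub_eq_zero.1 hx⟩
  refine ae_eq_zero_of_forall_isTest (hk.sub (integrable_const c)) fun φ hφ => ?_
  obtain ⟨ψ, hψ, hψφ⟩ := hφ.exists_deriv_eq_sub hρ hρ1
  have hφk := h ψ hψ
  rw [hψφ, hφ.integral_sub_smul_smul hρ _ hk, ← hc, sub_eq_zero] at hφk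
  simp only [smul_sub]
  rw [integral_sub (hφ.integrable_smul hk) (hφ.integrable_smul (integrable_const c)), hφk,
    hφ.integral_smul_eq (fun _ => c), integral_smul_const, sub_self]

lemma integrable_smul_const (c : E) : Integrable (fun x : ℝ => x • c) intervalMeasure :=
  ((by fun_prop : Continuous fun x : ℝ => x • c).integrableOn_Icc (a := 0) (b := 1)).mono_set
    Ioo_subset_Icc_self

lemma exists_ae_eq_affine_of_integral_deriv_deriv_smul_eq_zero [CompleteSpace E]
    (hk : Integrable k intervalMeasure)
    (h : ∀ φ, IsTest φ → ∫ x, deriv (deriv φ) x • k x ∂intervalMeasure = 0) :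
    ∃ c d : E, k =ᵐ[intervalMeasure] fun x => c + x • d := by
  obtain ⟨ρ, hρ, hρ1⟩ := IsTest.exists_integral_eq_one
  set d := -∫ x, deriv ρ x • k x ∂intervalMeasure with hd
  have hsub : Integrable (fun x => k x - x • d) intervalMeasure :=
    hk.sub (integrable_smul_const d)
  obtain ⟨c, hc⟩ := exists_ae_eq_const_of_integral_deriv_smul_eq_zero hsub fun φ hφ => by
    obtain ⟨ψ, hψ, hψφ⟩ := hφ.exists_deriv_eq_sub hρ hρ1
    have hψφ' : deriv (deriv ψ) = deriv φ - (∫ x, φ x) • deriv ρ := funext fun x => by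
      rw [hψφ]
      exact ((hφ.hasDerivAt x).sub ((hρ.hasDerivAt x).const_smul _)).deriv
    have hφk := h ψ hψ
    rw [hψφ', hφ.deriv.integral_sub_smul_smul hρ.deriv _ hk, sub_eq_zero] at hφk
    simp only [smul_sub]
    rw [integral_sub (hφ.deriv.integrable_smul hk)
      (hφ.deriv.integrable_smul (integrable_smul_const d)), hφk, hφ.deriv.integral_smul_eq]
    simp only [smul_smul, mul_comm (deriv φ _)]
    rw [integral_smul_const, hφ.integral_mul_deriv, hd, smul_neg, neg_smul, neg_neg, sub_self]
  refine ⟨c, d, hc.mono fun x hx => sub_eq_iff_eq_add.1 hx⟩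

end Weak

lemma eq_zero_of_hasWeakSecondDeriv_zero {k : L2} (hk : HasWeakSecondDeriv k 0)
    (hk' : VanishesAtEndpoints k) : k = 0 := by
  obtain ⟨c, d, hcd⟩ := exists_ae_eq_affine_of_integral_deriv_deriv_smul_eq_zero
    (integrable_coeFn k) fun φ hφ => by
      rw [← hφ.deriv.deriv.inner_toL2, hasWeakSecondDeriv_iff.1 hk φ hφ, inner_zero_right]
  obtain ⟨F, hF, hkF, hF0, hF1⟩ := hk'
  have heq : EqOn F (fun x => c + x • d) (Icc 0 1) := by
    refine Measure.eqOn_Icc_of_ae_eq volume zero_ne_one ?_ hF (by fun_prop)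
    rw [← restrict_Ioo_eq_restrict_Icc]
    exact hkF.symm.trans hcd
  have hc : c = 0 := by simpa [hF0] using (heq (left_mem_Icc.2 zero_le_one)).symm
  have hd : d = 0 := by simpa [hF1, hc] using (heq (right_mem_Icc.2 zero_le_one)).symm
  rw [Lp.eq_zero_iff_ae_eq_zero]
  filter_upwards [hcd] with x hx
  simp [hx, hc, hd]

lemma eq_green_neg {f h : L2} (hf : VanishesAtEndpoints f) (H : HasWeakSecondDeriv f h) :
    f = green (-h) := by
  have hzero : HasWeakSecondDeriv (f - green (-h)) 0 := by
    simpa only [neg_neg, sub_self] using H.sub (hasWeakSecondDeriv_green (-h))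
  exact sub_eq_zero.1
    (eq_zero_of_hasWeakSecondDeriv_zero hzero (hf.sub (vanishesAtEndpoints_green (-h))))

lemma isSturmLiouville_iff {q : LInf} {f g : L2} :
    IsSturmLiouville q f g ↔ f = green (g - q • f) := by
  refine ⟨?_, fun h => ⟨h ▸ vanishesAtEndpoints_green _, -(g - q • f), ?_, by abel⟩⟩
  · rintro ⟨hf, h, H, rfl⟩
    rw [add_sub_cancel_right]
    exact eq_green_neg hf H
  · simpa only [← h] using hasWeakSecondDeriv_green (g - q • f)

lemma green_injective : Function.Injective green := by
  refine (injective_iff_map_eq_zero green).2 fun h hh => ?_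
  have hweak := hasWeakSecondDeriv_green h
  rw [hh, hasWeakSecondDeriv_iff] at hweak
  refine (Lp.eq_zero_iff_ae_eq_zero).2
    (ae_eq_zero_of_forall_isTest (integrable_coeFn h) fun φ hφ => ?_)
  rw [← hφ.inner_toL2, ← neg_eq_zero, ← inner_neg_right, ← hweak φ hφ, inner_zero_right]

/-! ### Hilbert bases -/

section HilbertBasis

variable {𝕜 ι H : Type*} [RCLike 𝕜] [NormedAddCommGroup H] [InnerProductSpace 𝕜 H]

lemma ext_inner_basis (b : HilbertBasis ι 𝕜 H) {x y : H}
    (h : ∀ i, inner 𝕜 (b i) x = inner 𝕜 (b i) y) : x = y :=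
  b.repr.injective <| lp.ext <| funext fun i => by rw [b.repr_apply_apply, b.repr_apply_apply, h]

lemma hasSum_norm_inner_sq (b : HilbertBasis ι 𝕜 H) (x : H) :
    HasSum (fun i => ‖inner 𝕜 (b i) x‖ ^ 2) (‖x‖ ^ 2) := by
  have h := (b.hasSum_inner_mul_inner x x).mapL (RCLike.reCLM (K := 𝕜))
  simpa only [RCLike.reCLM_apply, inner_mul_symm_re_eq_norm, inner_self_eq_norm_sq, norm_mul,
    norm_inner_symm x, ← sq] using h

lemma norm_le_of_norm_inner_le (b : HilbertBasis ι 𝕜 H) {x y : H} {C : ℝ} (hC : 0 ≤ C)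
    (h : ∀ i, ‖inner 𝕜 (b i) x‖ ≤ C * ‖inner 𝕜 (b i) y‖) : ‖x‖ ≤ C * ‖y‖ := by
  refine le_of_sq_le_sq ?_ (by positivity)
  rw [mul_pow]
  refine hasSum_le (fun i => ?_) (hasSum_norm_inner_sq b x)
    ((hasSum_norm_inner_sq b y).mul_left (C ^ 2))
  rw [← mul_pow]
  exact pow_le_pow_left₀ (norm_nonneg _) (h i) 2

lemma mem_orthogonal_of_inner_basis_eq_zero {V : Submodule 𝕜 H} [V.HasOrthogonalProjection]
    (b : HilbertBasis ι 𝕜 V) {x : H} (h : ∀ i, inner 𝕜 (b i : H) x = 0) : x ∈ Vᗮ := by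
  rw [← V.orthogonalProjectionOnto_eq_zero_iff]
  refine ext_inner_basis b fun i => ?_
  rw [V.inner_orthogonalProjectionOnto_eq_of_mem_left, h, inner_zero_right]

theorem exists_hilbertBasis_subset_iUnion [CompleteSpace H] {κ : Type*} {V : κ → Submodule 𝕜 H}
    [∀ k, CompleteSpace (V k)] (hV : OrthogonalFamily 𝕜 (fun k => V k) fun k => (V k).subtypeₗᵢ)
    (htop : (⨆ k, V k)ᗮ = ⊥) :
    ∃ (s : Set H) (b : HilbertBasis s 𝕜 H), (⇑b = ((↑) : s → H)) ∧ s ⊆ ⋃ k, V k := by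
  choose w c _ using fun k => exists_hilbertBasis 𝕜 (V k)
  let v : (Σ k, w k) → H := fun a => (c a.1 a.2 : H)
  have hv : Orthonormal 𝕜 v := hV.orthonormal_sigma_orthonormal fun k => (c k).orthonormal
  have hbot : (Submodule.span 𝕜 (range ((↑) : range v → H)))ᗮ = ⊥ := by
    rw [Subtype.range_coe, eq_bot_iff, ← htop, ← Submodule.iInf_orthogonal]
    refine fun x hx => Submodule.mem_iInf _ |>.2 fun k =>
      mem_orthogonal_of_inner_basis_eq_zero (c k) fun i => ?_
    exact (Submodule.mem_orthogonal _ _).1 hx _ (Submodule.subset_span ⟨⟨k, i⟩, rfl⟩)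
  refine ⟨range v, .mkOfOrthogonalEqBot hv.toSubtypeRange hbot,
    HilbertBasis.coe_mkOfOrthogonalEqBot _ _, ?_⟩
  rintro _ ⟨⟨k, i⟩, rfl⟩
  exact mem_iUnion.2 ⟨k, (c k i).2⟩

theorem exists_hilbertBasis_eigenvectors [CompleteSpace H] {T : H →L[𝕜] H}
    (hT : IsCompactOperator T) (hs : (T : H →ₗ[𝕜] H).IsSymmetric) :
    ∃ (s : Set H) (b : HilbertBasis s 𝕜 H) (ν : s → ℝ), ∀ i, T (b i) = (ν i : 𝕜) • b i := by
  have hcomplete (μ : 𝕜) : CompleteSpace (Module.End.eigenspace (T : H →ₗ[𝕜] H) μ) := by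
    refine IsClosed.completeSpace_coe (hs := ?_)
    have heq : (Module.End.eigenspace (T : H →ₗ[𝕜] H) μ : Set H) = {x | T x = μ • x} :=
      ext fun x => Module.End.mem_eigenspace_iff
    exact heq ▸ isClosed_eq T.continuous (continuous_const_smul μ)
  obtain ⟨s, b, hb, hsub⟩ := exists_hilbertBasis_subset_iUnion hs.orthogonalFamily_eigenspaces
    (ContinuousLinearMap.orthogonalComplement_iSup_eigenspaces_eq_bot hT hs)
  choose μ hμ using fun i : s => mem_iUnion.1 (hsub i.2)
  refine ⟨s, b, fun i => RCLike.re (μ i), fun i => ?_⟩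
  have hmem : b i ∈ Module.End.eigenspace (T : H →ₗ[𝕜] H) (μ i) := by rw [hb]; exact hμ i
  have hreal : (starRingEnd 𝕜) (μ i) = μ i := hs.conj_eigenvalue_eq_self
    (Module.End.hasEigenvalue_of_hasEigenvector ⟨hmem, b.orthonormal.ne_zero i⟩)
  rw [RCLike.conj_eq_iff_re.1 hreal]
  exact Module.End.mem_eigenspace_iff.1 hmem

end HilbertBasis

/-! ### Eigenfunctions of the Sturm-Liouville operator -/

section Resolvent

variable {𝕜 H K : Type*} [RCLike 𝕜] [NormedAddCommGroup H] [InnerProductSpace 𝕜 H]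
  [CompleteSpace H] [NormedAddCommGroup K] [InnerProductSpace 𝕜 K] [CompleteSpace K]

open ContinuousLinearMap in
lemma isUnit_one_add_of_isPositive {P : H →L[𝕜] H} (hP : P.IsPositive) : IsUnit (1 + P) := by
  refine isUnit_of_forall_le_norm_inner_map (c := 1) _ one_pos fun x => ?_
  refine le_trans ?_ (RCLike.re_le_norm _)
  rw [add_apply, inner_add_left, map_add, one_apply_eq_self, inner_self_eq_norm_sq,
    NNReal.coe_one, mul_one]
  exact le_add_of_nonneg_right (hP.re_inner_nonneg_left x)

open ContinuousLinearMap in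
-- `R = (A + V)⁻¹` where `A⁻¹ = B B†`; conjugating by `B` gives the bounded formula
-- `R = B (1 + B† V B)⁻¹ B†`.
theorem exists_isCompactOperator_resolvent {B : H →L[𝕜] K} (hB : IsCompactOperator B)
    {V : K →L[𝕜] K} (hV : V.IsPositive) :
    ∃ R : K →L[𝕜] K, IsCompactOperator R ∧ (R : K →ₗ[𝕜] K).IsSymmetric ∧
      ∀ g, R g = (B ∘L adjoint B) (g - V (R g)) := by
  have hP := hV.adjoint_conj B
  obtain ⟨U, hU⟩ := isUnit_one_add_of_isPositive hP
  let S : H →L[𝕜] H := ↑U⁻¹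
  have hS_inv (x : H) : S x + (adjoint B ∘L V ∘L B) (S x) = x := by
    have h : (1 + adjoint B ∘L V ∘L B) * S = 1 := by rw [← hU]; exact U.mul_inv
    exact DFunLike.congr_fun h x
  have hS_symm : IsSelfAdjoint S := by
    have hU_symm : IsSelfAdjoint U := Units.ext <| by
      rw [Units.coe_star, hU, (isPositive_one.add hP).isSelfAdjoint.star_eq]
    exact congrArg Units.val hU_symm.inv
  refine ⟨B ∘L S ∘L adjoint B, hB.comp_clm _, fun x y => ?_, fun g => ?_⟩
  · have h := hS_symm.isSymmetric (adjoint B x) (adjoint B y)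
    rw [coe_coe, adjoint_inner_right] at h
    simpa [adjoint_inner_left] using h
  · simp only [comp_apply, map_sub] at hS_inv ⊢
    rw [← map_sub, sub_eq_of_eq_add (hS_inv _).symm]

end Resolvent

section SturmLiouvilleOperator

variable {q : LInf}

/-- Multiplication by a bounded function, as an operator on `L²(0,1)`. -/
noncomputable def mulL (q : LInf) : L2 →L[ℂ] L2 :=
  LinearMap.mkContinuous
    { toFun := fun f => q • f
      map_add' := Lp.add_smul q
      map_smul' := fun c f => by
        refine Lp.ext ?_
        filter_upwards [Lp.coeFn_lpSMul (r := 2) q f, Lp.coeFn_lpSMul (r := 2) q (c • f),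
          Lp.coeFn_smul c f, Lp.coeFn_smul c (q • f : L2)] with x h₁ h₂ h₃ h₄
        rw [h₂, RingHom.id_apply, h₄, Pi.smul_apply, h₁, Pi.smul_apply', Pi.smul_apply', h₃,
          Pi.smul_apply, smul_comm] }
    ‖q‖ (Lp.norm_smul_le q)

lemma mulL_apply (q : LInf) (f : L2) : mulL q f = q • f := rfl

lemma inner_mulL_left (q : LInf) (f g : L2) :
    inner ℂ (mulL q f) g = inner ℂ f (mulL q g) := by
  rw [L2.inner_def, L2.inner_def]
  refine integral_congr_ae ?_
  filter_upwards [Lp.coeFn_lpSMul (r := 2) q f, Lp.coeFn_lpSMul (r := 2) q g] with x h₁ h₂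
  rw [mulL_apply, mulL_apply, h₁, h₂]
  simp only [Pi.smul_apply', inner_smul_left_eq_smul, inner_smul_right_eq_smul]

lemma re_inner_mulL_nonneg {a : LInf} (ha : 0 ≤ a) (f : L2) :
    0 ≤ (inner ℂ f (mulL a f)).re := by
  have hre := integral_re (L2.integrable_inner (𝕜 := ℂ) f (mulL a f))
  simp only [RCLike.re_eq_complex_re] at hre
  rw [L2.inner_def, ← hre]
  refine integral_nonneg_of_ae ?_
  filter_upwards [Lp.coeFn_lpSMul (r := 2) a f, (Lp.coeFn_nonneg a).2 ha] with x hx hax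
  rw [mulL_apply, hx]
  simp only [Pi.smul_apply', inner_smul_right_eq_smul, Pi.zero_apply, Complex.smul_re,
    smul_eq_mul] at hax ⊢
  exact mul_nonneg hax (inner_self_nonneg (𝕜 := ℂ) (x := f x))

lemma abs_re_inner_mulL_le (q : LInf) (f : L2) :
    |(inner ℂ f (mulL q f)).re| ≤ ‖q‖ * ‖f‖ ^ 2 := by
  calc |(inner ℂ f (mulL q f)).re| ≤ ‖f‖ * ‖q • f‖ :=
        (Complex.abs_re_le_norm _).trans (norm_inner_le_norm _ _)
    _ ≤ ‖f‖ * (‖q‖ * ‖f‖) := by gcongr; exact Lp.norm_smul_le (r := 2) q f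
    _ = ‖q‖ * ‖f‖ ^ 2 := by ring

lemma isPositive_mulL_add_norm (q : LInf) : (mulL q + (‖q‖ : ℂ) • 1).IsPositive := by
  have happly (f : L2) : (mulL q + (‖q‖ : ℂ) • 1) f = mulL q f + (‖q‖ : ℂ) • f := rfl
  refine ⟨fun f g => ?_, fun f => ?_⟩
  · rw [ContinuousLinearMap.coe_coe, happly, happly, inner_add_left, inner_add_right,
      inner_smul_left, inner_smul_right, Complex.conj_ofReal, inner_mulL_left]
  · have hself : (inner ℂ f f).re = ‖f‖ ^ 2 := inner_self_eq_norm_sq (𝕜 := ℂ) f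
    rw [ContinuousLinearMap.reApplyInnerSelf_apply, happly, inner_add_left, inner_smul_left,
      Complex.conj_ofReal, inner_mulL_left, RCLike.re_eq_complex_re, Complex.add_re,
      Complex.re_ofReal_mul, hself]
    linarith [(abs_le.1 (abs_re_inner_mulL_le q f)).1]

namespace IsSturmLiouville

variable {f g f' g' : L2}

lemma inner_eq (h : IsSturmLiouville q f g) (h' : IsSturmLiouville q f' g') :
    inner ℂ g f' = inner ℂ f g' := by
  have hgreen : inner ℂ (g - q • f) f' = inner ℂ f (g' - q • f') := by
    conv_lhs => rw [isSturmLiouville_iff.1 h']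
    conv_rhs => rw [isSturmLiouville_iff.1 h]
    rw [inner_green_left]
  rw [inner_sub_left, inner_sub_right, ← mulL_apply, ← mulL_apply, inner_mulL_left] at hgreen
  exact sub_left_injective hgreen

lemma add (h : IsSturmLiouville q f g) (h' : IsSturmLiouville q f' g') :
    IsSturmLiouville q (f + f') (g + g') := by
  rw [isSturmLiouville_iff, ← mulL_apply] at *
  rw [map_add, add_sub_add_comm, map_add, ← h, ← h']

lemma smul (h : IsSturmLiouville q f g) (c : ℂ) : IsSturmLiouville q (c • f) (c • g) := by
  rw [isSturmLiouville_iff, ← mulL_apply] at *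
  rw [map_smul, ← smul_sub, map_smul, ← h]

lemma zero (q : LInf) : IsSturmLiouville q 0 0 := by
  rw [isSturmLiouville_iff, ← mulL_apply, map_zero, sub_zero, map_zero]

lemma sum {ι : Type*} {f g : ι → L2} (h : ∀ i, IsSturmLiouville q (f i) (g i)) (s : Finset ι) :
    IsSturmLiouville q (∑ i ∈ s, f i) (∑ i ∈ s, g i) := by
  classical
  induction s using Finset.induction_on with
  | empty => simpa only [Finset.sum_empty] using zero q
  | insert i s hi ih => rw [Finset.sum_insert hi, Finset.sum_insert hi]; exact (h i).add ih

lemma norm_sq_adjoint_dirichletPrimitive_le (h : IsSturmLiouville q f g) :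
    ‖ContinuousLinearMap.adjoint dirichletPrimitive (g - q • f)‖ ^ 2 ≤
      (inner ℂ f g).re + ‖q‖ * ‖f‖ ^ 2 := by
  have heq : ‖ContinuousLinearMap.adjoint dirichletPrimitive (g - q • f)‖ ^ 2 =
      (inner ℂ f g).re - (inner ℂ f (mulL q f)).re := by
    rw [← inner_self_eq_norm_sq (𝕜 := ℂ), ContinuousLinearMap.adjoint_inner_right,
      ← ContinuousLinearMap.comp_apply, ← green, ← isSturmLiouville_iff.1 h, inner_sub_right]
    rfl
  linarith [(abs_le.1 (abs_re_inner_mulL_le q f)).1]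

end IsSturmLiouville

lemma IsEigenpair.neg_norm_le {l : ℝ} {φ : L2} (h : IsEigenpair q l φ) : -‖q‖ ≤ l := by
  have hinner : (inner ℂ φ ((l : ℂ) • φ)).re = l * ‖φ‖ ^ 2 := by
    rw [inner_smul_right, Complex.re_ofReal_mul, ← inner_self_eq_norm_sq (𝕜 := ℂ)]
    rfl
  have hφ : 0 < ‖φ‖ ^ 2 := pow_pos (norm_pos_iff.2 h.1) 2
  have hnonneg := (sq_nonneg _).trans h.2.norm_sq_adjoint_dirichletPrimitive_le
  rw [hinner, ← add_mul] at hnonneg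
  linarith [nonneg_of_mul_nonneg_left hnonneg hφ]

/-- A Hilbert basis of eigenfunctions of the Sturm-Liouville operator, with eigenvalues `l`. -/
def IsEigenbasis {ι : Type*} (q : LInf) (l : ι → ℝ) (b : HilbertBasis ι ℂ L2) : Prop :=
  ∀ i, IsEigenpair q (l i) (b i)

theorem exists_isEigenbasis (q : LInf) :
    ∃ (s : Set L2) (b : HilbertBasis s ℂ L2) (l : s → ℝ), IsEigenbasis q l b := by
  obtain ⟨R, hR_compact, hR_symm, hR⟩ := exists_isCompactOperator_resolvent
    isCompactOperator_dirichletPrimitive (isPositive_mulL_add_norm q)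
  obtain ⟨s, b, ν, hb⟩ := exists_hilbertBasis_eigenvectors hR_compact hR_symm
  refine ⟨s, b, fun i => (ν i)⁻¹ - ‖q‖, fun i => ⟨b.orthonormal.ne_zero i, ?_⟩⟩
  have hgreen : (ν i : ℂ) • b i =
      green (b i - (ν i : ℂ) • (mulL q (b i) + (‖q‖ : ℂ) • b i)) := by
    have h := hR (b i)
    rwa [hb, map_smul] at h
  have hν : (ν i : ℂ) ≠ 0 := fun h0 => b.orthonormal.ne_zero i <| green_injective <| by
    rw [h0, zero_smul, zero_smul, sub_zero] at hgreen
    rw [← hgreen, map_zero]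
  have hinv : b i = green ((ν i : ℂ)⁻¹ • b i - (mulL q (b i) + (‖q‖ : ℂ) • b i)) := by
    rw [← smul_right_inj hν, ← map_smul green, smul_sub, smul_inv_smul₀ hν, hgreen]
  rw [isSturmLiouville_iff, ← mulL_apply]
  convert hinv using 2
  push_cast
  rw [sub_smul]
  abel

section Eigenbasis

variable {ι : Type*} {b : HilbertBasis ι ℂ L2} {l : ι → ℝ}

namespace IsEigenbasis

lemma inner_of_isSturmLiouville (hb : IsEigenbasis q l b) {f g : L2}
    (h : IsSturmLiouville q f g) (i : ι) : inner ℂ (b i) g = l i * inner ℂ (b i) f := by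
  rw [← (hb i).2.inner_eq h, inner_smul_left, Complex.conj_ofReal]

lemma inner_eq_zero (hb : IsEigenbasis q l b) {m : ℝ} {φ : L2} (h : IsEigenpair q m φ) {i : ι}
    (hi : l i ≠ m) : inner ℂ (b i) φ = 0 := by
  have heq := hb.inner_of_isSturmLiouville h.2 i
  rw [inner_smul_right] at heq
  have hne : (m : ℂ) ≠ l i := by exact_mod_cast hi.symm
  exact (mul_eq_mul_right_iff.1 heq).resolve_left hne

lemma isFractionalPower (hb : IsEigenbasis q l b) {s : ℝ} {f g : L2}
    (h : ∀ i, inner ℂ (b i) g = (l i : ℂ) ^ (s : ℂ) * inner ℂ (b i) f) :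
    IsFractionalPower q s f g := by
  intro m φ hφ
  rw [← b.tsum_inner_mul_inner, ← b.tsum_inner_mul_inner, ← tsum_mul_left]
  refine tsum_congr fun i => ?_
  by_cases hi : l i = m
  · rw [h, hi, mul_left_comm]
  · rw [← inner_conj_symm, hb.inner_eq_zero hφ hi, map_zero, zero_mul, zero_mul, mul_zero]

lemma isSturmLiouville_sum (hb : IsEigenbasis q l b) (c : ι → ℂ) (s : Finset ι) :
    IsSturmLiouville q (∑ i ∈ s, c i • b i) (∑ i ∈ s, (c i * l i) • b i) := by
  simp_rw [mul_smul]
  exact .sum (fun i => (hb i).2.smul (c i)) s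

lemma norm_sq_adjoint_dirichletPrimitive_sum_le (hb : IsEigenbasis q l b) (c : ι → ℂ)
    (s : Finset ι) :
    ‖∑ i ∈ s, ContinuousLinearMap.adjoint dirichletPrimitive
        ((c i * l i) • b i - q • (c i • b i))‖ ^ 2 ≤ ∑ i ∈ s, (|l i| + ‖q‖) * ‖c i‖ ^ 2 := by
  have h := (hb.isSturmLiouville_sum c s).norm_sq_adjoint_dirichletPrimitive_le
  have hnorm : ‖∑ i ∈ s, c i • b i‖ ^ 2 = ∑ i ∈ s, ‖c i‖ ^ 2 := by
    rw [← inner_self_eq_norm_sq (𝕜 := ℂ), b.orthonormal.inner_sum, map_sum]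
    refine Finset.sum_congr rfl fun i _ => ?_
    rw [RCLike.conj_mul, RCLike.re_eq_complex_re]
    exact_mod_cast rfl
  have hinner : (inner ℂ (∑ i ∈ s, c i • b i) (∑ i ∈ s, (c i * l i) • b i)).re =
      ∑ i ∈ s, l i * ‖c i‖ ^ 2 := by
    rw [b.orthonormal.inner_sum, Complex.re_sum]
    refine Finset.sum_congr rfl fun i _ => ?_
    rw [← mul_assoc, RCLike.conj_mul, mul_comm, Complex.re_ofReal_mul]
    exact_mod_cast rfl
  rw [hnorm, hinner, Finset.mul_sum, ← Finset.sum_add_distrib, ← mulL_apply, map_sum,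
    ← Finset.sum_sub_distrib, map_sum] at h
  refine h.trans (Finset.sum_le_sum fun i _ => ?_)
  rw [← add_mul]
  gcongr
  exact le_abs_self _

-- By the energy estimate, `B† (𝓛 - q)` maps the expansion of `u` to a convergent series, and `B`
-- maps the sum of that series back to `u`.
lemma vanishesAtEndpoints (hb : IsEigenbasis q l b) {u : L2}
    (hu : Summable fun i => |l i| * ‖inner ℂ (b i) u‖ ^ 2) : VanishesAtEndpoints u := by
  set c : ι → ℂ := fun i => inner ℂ (b i) u
  let v : ι → L2 := fun i =>
    ContinuousLinearMap.adjoint dirichletPrimitive ((c i * l i) • b i - q • (c i • b i))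
  have hv (i : ι) : dirichletPrimitive (v i) = c i • b i := by
    simp only [v, mul_smul]
    exact (isSturmLiouville_iff.1 ((hb i).2.smul (c i))).symm
  have henergy : Summable fun i => (|l i| + ‖q‖) * ‖c i‖ ^ 2 := by
    simp_rw [add_mul]
    exact hu.add ((hasSum_norm_inner_sq b u).summable.mul_left _)
  have hsum : Summable v := by
    rw [summable_iff_vanishing_norm]
    intro ε hε
    obtain ⟨s, hs⟩ := summable_iff_vanishing_norm.1 henergy (ε ^ 2) (by positivity)
    refine ⟨s, fun t ht => lt_of_pow_lt_pow_left₀ 2 hε.le ?_⟩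
    exact (hb.norm_sq_adjoint_dirichletPrimitive_sum_le c t).trans_lt
      ((le_abs_self _).trans_lt (hs t ht))
  have hu_sum : HasSum (fun i => c i • b i) u := by
    simpa only [b.repr_apply_apply] using b.hasSum_repr u
  have hBsum := hsum.hasSum.mapL dirichletPrimitive
  simp_rw [hv] at hBsum
  exact hu_sum.unique hBsum ▸ vanishesAtEndpoints_dirichletPrimitive _

end IsEigenbasis

end Eigenbasis

end SturmLiouvilleOperator

/-! ### Diagonal operators -/

section Diagonal

variable {𝕜 ι H : Type*} [RCLike 𝕜] [NormedAddCommGroup H] [InnerProductSpace 𝕜 H]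

lemma memℓp_mul_inner_basis (b : HilbertBasis ι 𝕜 H) {m : ι → 𝕜} {C : ℝ}
    (hm : ∀ i, ‖m i‖ ≤ C) (x : H) : Memℓp (fun i => m i * inner 𝕜 (b i) x) 2 := by
  refine memℓp_gen <| ((hasSum_norm_inner_sq b x).summable.mul_left (C ^ 2)).of_nonneg_of_le
    (fun i => by positivity) fun i => ?_
  simp only [ENNReal.toReal_ofNat, Real.rpow_ofNat, norm_mul, mul_pow]
  gcongr
  exact hm i

/-- The operator that multiplies the coordinates in a Hilbert basis by a bounded family of
scalars. -/
noncomputable def diagonal (b : HilbertBasis ι 𝕜 H) {m : ι → 𝕜} {C : ℝ}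
    (hm : ∀ i, ‖m i‖ ≤ C) : H →L[𝕜] H :=
  LinearMap.mkContinuous
    { toFun := fun x => b.repr.symm ⟨_, memℓp_mul_inner_basis b hm x⟩
      map_add' := fun x y => ext_inner_basis b fun i => by
        simp only [← b.repr_apply_apply, LinearIsometryEquiv.apply_symm_apply, mul_add, map_add,
          lp.coeFn_add, Pi.add_apply]
      map_smul' := fun c x => ext_inner_basis b fun i => by
        simp only [← b.repr_apply_apply, LinearIsometryEquiv.apply_symm_apply,
          map_smul, lp.coeFn_smul, Pi.smul_apply, smul_eq_mul, mul_left_comm, RingHom.id_apply] }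
    (max C 0) fun x => norm_le_of_norm_inner_le b (le_max_right _ _) fun i => by
      simp only [LinearMap.coe_mk, AddHom.coe_mk, ← b.repr_apply_apply,
        LinearIsometryEquiv.apply_symm_apply, norm_mul]
      gcongr
      exact (hm i).trans (le_max_left _ _)

lemma inner_diagonal (b : HilbertBasis ι 𝕜 H) {m : ι → 𝕜} {C : ℝ} (hm : ∀ i, ‖m i‖ ≤ C) (x : H)
    (i : ι) : inner 𝕜 (b i) (diagonal b hm x) = m i * inner 𝕜 (b i) x := by
  rw [← b.repr_apply_apply]
  exact congr_fun (congr_arg _ (b.repr.apply_symm_apply ⟨_, memℓp_mul_inner_basis b hm x⟩)) i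

lemma norm_diagonal_apply_le (b : HilbertBasis ι 𝕜 H) {m : ι → 𝕜} {C : ℝ}
    (hm : ∀ i, ‖m i‖ ≤ C) (hC : 0 ≤ C) (x : H) : ‖diagonal b hm x‖ ≤ C * ‖x‖ :=
  norm_le_of_norm_inner_le b hC fun i => by
    rw [inner_diagonal, norm_mul]
    gcongr
    exact hm i

variable {X : Type*} [TopologicalSpace X]

lemma continuous_diagonal_apply (b : HilbertBasis ι 𝕜 H) {m : X → ι → 𝕜} {C : ℝ}
    (hm : ∀ x i, ‖m x i‖ ≤ C) (hcont : ∀ i, Continuous fun x => m x i) (v : H) :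
    Continuous fun x => diagonal b (hm x) v := by
  rw [continuous_iff_continuousAt]
  intro x₀
  rw [ContinuousAt, tendsto_iff_norm_sub_tendsto_zero]
  have hsq (x : X) : ‖diagonal b (hm x) v - diagonal b (hm x₀) v‖ ^ 2 =
      ∑' i, ‖(m x i - m x₀ i) * inner 𝕜 (b i) v‖ ^ 2 := by
    rw [← (hasSum_norm_inner_sq b _).tsum_eq]
    simp only [inner_sub_right, inner_diagonal, sub_mul]
  have htends : Tendsto (fun x => ‖diagonal b (hm x) v - diagonal b (hm x₀) v‖ ^ 2) (𝓝 x₀)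
      (𝓝 0) := by
    simp_rw [hsq]
    rw [← tsum_zero (α := ℝ) (β := ι)]
    refine tendsto_tsum_of_dominated_convergence
      ((hasSum_norm_inner_sq b v).summable.mul_left ((C + C) ^ 2)) (fun i => ?_)
      (Eventually.of_forall fun x i => ?_)
    · have hc : Continuous fun x => ‖(m x i - m x₀ i) * inner 𝕜 (b i) v‖ ^ 2 :=
        (((hcont i).sub continuous_const).mul continuous_const).norm.pow 2
      simpa only [sub_self, zero_mul, norm_zero, zero_pow two_ne_zero] using hc.tendsto x₀
    · rw [norm_pow, norm_norm, norm_mul, mul_pow]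
      gcongr
      exact (norm_sub_le _ _).trans (add_le_add (hm x i) (hm x₀ i))
  simpa only [Real.sqrt_sq (norm_nonneg _), Real.sqrt_zero] using htends.sqrt

lemma continuous_diagonal (b : HilbertBasis ι 𝕜 H) {m : X → ι → 𝕜} {C : ℝ}
    (hm : ∀ x i, ‖m x i‖ ≤ C) (hC : 0 ≤ C) (hcont : ∀ i, Continuous fun x => m x i) :
    Continuous fun z : X × H => diagonal b (hm z.1) z.2 := by
  rw [continuous_iff_continuousAt]
  rintro ⟨x₀, v₀⟩
  rw [ContinuousAt, tendsto_iff_norm_sub_tendsto_zero]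
  let bound : X × H → ℝ := fun z =>
    C * ‖z.2 - v₀‖ + ‖diagonal b (hm z.1) v₀ - diagonal b (hm x₀) v₀‖
  refine squeeze_zero (g := bound) (fun _ => norm_nonneg _) (fun z => ?_) ?_
  · rw [← sub_add_sub_cancel _ (diagonal b (hm z.1) v₀), ← map_sub]
    exact (norm_add_le _ _).trans (add_le_add_left (norm_diagonal_apply_le b (hm z.1) hC _) _)
  · have hbound : Continuous bound := (continuous_const.mul
      (continuous_snd.sub continuous_const).norm).add
        (((continuous_diagonal_apply b hm hcont v₀).comp continuous_fst).sub
          continuous_const).norm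
    simpa only [bound, sub_self, norm_zero, mul_zero, add_zero] using hbound.tendsto (x₀, v₀)

end Diagonal

section Curves

variable {𝕜 ι H : Type*} [RCLike 𝕜] [NormedAddCommGroup H] [InnerProductSpace 𝕜 H]
  [NormedSpace ℝ H] [CompleteSpace H] {T : ℝ}

lemma hasDerivWithinAt_of_inner_basis (b : HilbertBasis ι 𝕜 H) (hT : 0 ≤ T) {y g : ℝ → H}
    (hg : ContinuousOn g (Icc 0 T))
    (h : ∀ i, ∀ t ∈ Icc 0 T, HasDerivWithinAt (fun t => inner 𝕜 (b i) (y t))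
      (inner 𝕜 (b i) (g t)) (Icc 0 T) t) {t : ℝ} (ht : t ∈ Icc 0 T) :
    HasDerivWithinAt y (g t) (Icc 0 T) t := by
  let G : ℝ → H := IccExtend hT ((Icc 0 T).domRestrict g)
  have hG : Continuous G := continuous_IccExtend_iff.2 hg.domRestrict
  have hGg {t : ℝ} (ht : t ∈ Icc 0 T) : G t = g t := IccExtend_of_mem hT _ ht
  have hint (t : ℝ) := (hG.integral_hasStrictDerivAt 0 t).hasDerivAt
  have hy {t : ℝ} (ht : t ∈ Icc 0 T) : y t = y 0 + ∫ s in (0 : ℝ)..t, G s := by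
    refine ext_inner_basis b fun i => ?_
    have hconst : ∀ t ∈ Icc 0 T, HasDerivWithinAt
        (fun t => inner 𝕜 (b i) (y t) - inner 𝕜 (b i) (∫ s in (0 : ℝ)..t, G s)) 0 (Icc 0 T) t := by
      intro t ht
      refine ((h i t ht).sub
        ((hasDerivAt_const t (b i)).inner 𝕜 (hint t)).hasDerivWithinAt).congr_deriv ?_
      rw [hGg ht, inner_zero_left, add_zero, sub_self]
    have hle := (convex_Icc 0 T).norm_image_sub_le_of_norm_hasDerivWithin_le (C := 0) hconst
      (fun _ _ => norm_zero.le) (left_mem_Icc.2 hT) ht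
    rw [zero_mul, norm_le_zero_iff, sub_eq_zero, intervalIntegral.integral_same,
      inner_zero_right, sub_zero] at hle
    rw [inner_add_right, ← hle, sub_add_cancel]
  exact hGg ht ▸ ((hint t).const_add (y 0)).hasDerivWithinAt.congr (fun _ => hy) (hy ht)

end Curves

/-! ### Global solutions of Lipschitz differential equations -/

section PicardCurve

variable {E : Type*} [NormedAddCommGroup E] [NormedSpace ℝ E] {T : ℝ} {A : ℝ → E → E}

/-- The Picard iterate of the curve `exp (k t) • x t` for the problem `y' = A t y`, `y 0 = y₀`. The
exponential weight makes Picard iteration a contraction on the whole of `[0,T]` when `k` is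
large. -/
noncomputable def picardCurve (hT : 0 ≤ T) (A : ℝ → E → E) (k : ℝ) (y₀ : E) (x : C(Icc 0 T, E))
    (t : ℝ) : E :=
  y₀ + ∫ s in (0 : ℝ)..t, A s (Real.exp (k * s) • IccExtend hT x s)

lemma continuous_picardCurve_integrand (hT : 0 ≤ T) (hA : Continuous fun z : ℝ × E => A z.1 z.2)
    (k : ℝ) (x : C(Icc 0 T, E)) :
    Continuous fun s => A s (Real.exp (k * s) • IccExtend hT x s) :=
  hA.comp (continuous_id.prodMk
    ((by fun_prop : Continuous fun s => Real.exp (k * s)).smul x.continuous.Icc_extend'))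

lemma hasDerivAt_picardCurve [CompleteSpace E] (hT : 0 ≤ T)
    (hA : Continuous fun z : ℝ × E => A z.1 z.2) (k : ℝ) (y₀ : E) (x : C(Icc 0 T, E)) (t : ℝ) :
    HasDerivAt (picardCurve hT A k y₀ x) (A t (Real.exp (k * t) • IccExtend hT x t)) t :=
  ((continuous_picardCurve_integrand hT hA k x).integral_hasStrictDerivAt 0 t).hasDerivAt.const_add
    y₀

lemma integral_exp_mul_le {k : ℝ} (hk : 0 < k) (t : ℝ) :
    ∫ s in (0 : ℝ)..t, Real.exp (k * s) ≤ Real.exp (k * t) / k := by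
  rw [intervalIntegral.integral_comp_mul_left _ hk.ne', integral_exp, mul_zero, Real.exp_zero,
    smul_eq_mul, inv_mul_eq_div]
  gcongr
  linarith

lemma norm_picardCurve_sub_le (hT : 0 ≤ T) (hA : Continuous fun z : ℝ × E => A z.1 z.2)
    {K : NNReal} (hL : ∀ t, LipschitzWith K (A t)) {k : ℝ} (hk : 0 < k) (y₀ : E)
    (x x' : C(Icc 0 T, E)) {t : ℝ} (ht : 0 ≤ t) :
    ‖picardCurve hT A k y₀ x t - picardCurve hT A k y₀ x' t‖ ≤
      K / k * dist x x' * Real.exp (k * t) := by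
  have hx := continuous_picardCurve_integrand hT hA k x
  have hx' := continuous_picardCurve_integrand hT hA k x'
  have hint : ‖picardCurve hT A k y₀ x t - picardCurve hT A k y₀ x' t‖ ≤
      ∫ s in (0 : ℝ)..t, K * dist x x' * Real.exp (k * s) := by
    rw [picardCurve, picardCurve, add_sub_add_left_eq_sub, ← intervalIntegral.integral_sub
      (hx.intervalIntegrable _ _) (hx'.intervalIntegrable _ _)]
    refine intervalIntegral.norm_integral_le_of_norm_le ht (ae_of_all _ fun s _ => ?_)
      (Continuous.intervalIntegrable (by fun_prop) _ _)
    refine ((hL s).norm_sub_le _ _).trans ?_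
    rw [← smul_sub, norm_smul, Real.norm_of_nonneg (Real.exp_pos _).le, mul_assoc,
      mul_comm (Real.exp _), ← dist_eq_norm]
    gcongr
    exact ContinuousMap.dist_apply_le_dist _
  rw [intervalIntegral.integral_const_mul] at hint
  calc _ ≤ K * dist x x' * ∫ s in (0 : ℝ)..t, Real.exp (k * s) := hint
    _ ≤ K * dist x x' * (Real.exp (k * t) / k) := by gcongr; exact integral_exp_mul_le hk t
    _ = K / k * dist x x' * Real.exp (k * t) := by ring

lemma exists_picardCurve_fixed [CompleteSpace E] (hT : 0 ≤ T)
    (hA : Continuous fun z : ℝ × E => A z.1 z.2) {K : NNReal} (hL : ∀ t, LipschitzWith K (A t))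
    {k : ℝ} (hk : K < k) (y₀ : E) :
    ∃ x : C(Icc 0 T, E), ∀ t : Icc 0 T, x t = Real.exp (-(k * t)) • picardCurve hT A k y₀ x t := by
  have hk0 : 0 < k := K.2.trans_lt hk
  let Φ : C(Icc 0 T, E) → C(Icc 0 T, E) := fun x =>
    ⟨fun t => Real.exp (-(k * t)) • picardCurve hT A k y₀ x t, by
      have hcont : Continuous (picardCurve hT A k y₀ x) :=
        continuous_iff_continuousAt.2 fun t =>
          (hasDerivAt_picardCurve hT hA k y₀ x t).continuousAt
      exact Continuous.smul (by fun_prop) (hcont.comp continuous_subtype_val)⟩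
  have hΦ : ContractingWith (K / k.toNNReal) Φ := by
    refine ⟨?_, LipschitzWith.of_dist_le_mul fun x x' => ?_⟩
    · rw [div_lt_one (Real.toNNReal_pos.2 hk0)]
      exact Real.lt_toNNReal_iff_coe_lt.2 hk
    · rw [ContinuousMap.dist_le (by positivity)]
      intro t
      rw [dist_eq_norm, ContinuousMap.coe_mk, ContinuousMap.coe_mk, ← smul_sub, norm_smul,
        Real.norm_of_nonneg (Real.exp_pos _).le, Real.exp_neg, inv_mul_le_iff₀ (Real.exp_pos _),
        mul_comm (Real.exp _), NNReal.coe_div, Real.coe_toNNReal _ hk0.le]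
      exact norm_picardCurve_sub_le hT hA hL hk0 y₀ x x' t.2.1
  have : Nonempty (Icc 0 T) := ⟨⟨0, left_mem_Icc.2 hT⟩⟩
  exact ⟨ContractingWith.fixedPoint Φ hΦ, fun t =>
    (DFunLike.congr_fun hΦ.fixedPoint_isFixedPt t).symm⟩

theorem exists_solution_of_lipschitz [CompleteSpace E] (hT : 0 ≤ T)
    (hA : Continuous fun z : ℝ × E => A z.1 z.2) {K : NNReal} (hL : ∀ t, LipschitzWith K (A t))
    (y₀ : E) :
    ∃ y : ℝ → E, y 0 = y₀ ∧ ∀ t ∈ Icc 0 T, HasDerivWithinAt y (A t (y t)) (Icc 0 T) t := by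
  set k : ℝ := K + 1
  obtain ⟨x, hx⟩ := exists_picardCurve_fixed hT hA hL (lt_add_one (K : ℝ)) y₀
  refine ⟨picardCurve hT A k y₀ x, ?_, fun t ht => ?_⟩
  · rw [picardCurve, intervalIntegral.integral_same, add_zero]
  · have heq : Real.exp (k * t) • IccExtend hT x t = picardCurve hT A k y₀ x t := by
      rw [IccExtend_of_mem hT _ ht, hx, smul_smul, ← Real.exp_add, add_neg_cancel, Real.exp_zero,
        one_smul]
    exact heq ▸ (hasDerivAt_picardCurve hT hA k y₀ x t).hasDerivWithinAt

end PicardCurve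

/-! ### Oscillators -/

section Rotation

variable {𝕜 ι H : Type*} [RCLike 𝕜] [NormedAddCommGroup H] [InnerProductSpace 𝕜 H]

lemma norm_ofReal_cos_le (x : ℝ) : ‖((Real.cos x : ℝ) : 𝕜)‖ ≤ 1 := by
  rw [RCLike.norm_ofReal]
  exact Real.abs_cos_le_one x

lemma norm_ofReal_sin_le (x : ℝ) : ‖((Real.sin x : ℝ) : 𝕜)‖ ≤ 1 := by
  rw [RCLike.norm_ofReal]
  exact Real.abs_sin_le_one x

/-- The diagonal operator with entries `cos (ν i * t)`. -/
noncomputable def cosDiagonal (b : HilbertBasis ι 𝕜 H) (ν : ι → ℝ) (t : ℝ) : H →L[𝕜] H :=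
  diagonal b fun i => norm_ofReal_cos_le (ν i * t)

/-- The diagonal operator with entries `sin (ν i * t)`. -/
noncomputable def sinDiagonal (b : HilbertBasis ι 𝕜 H) (ν : ι → ℝ) (t : ℝ) : H →L[𝕜] H :=
  diagonal b fun i => norm_ofReal_sin_le (ν i * t)

/-- The rotation of the plane through the angle `ν i * t`, applied to the `i`-th coordinates of a
pair of vectors. -/
noncomputable def rotation (b : HilbertBasis ι 𝕜 H) (ν : ι → ℝ) (t : ℝ) : H × H →L[𝕜] H × H :=
  (cosDiagonal b ν t ∘L .fst 𝕜 H H - sinDiagonal b ν t ∘L .snd 𝕜 H H).prod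
    (sinDiagonal b ν t ∘L .fst 𝕜 H H + cosDiagonal b ν t ∘L .snd 𝕜 H H)

lemma rotation_apply (b : HilbertBasis ι 𝕜 H) (ν : ι → ℝ) (t : ℝ) (z : H × H) :
    rotation b ν t z = (cosDiagonal b ν t z.1 - sinDiagonal b ν t z.2,
      sinDiagonal b ν t z.1 + cosDiagonal b ν t z.2) := rfl

variable (b : HilbertBasis ι 𝕜 H) (ν : ι → ℝ)

lemma inner_rotation_fst (t : ℝ) (z : H × H) (i : ι) :
    inner 𝕜 (b i) (rotation b ν t z).1 =
      (Real.cos (ν i * t) : ℝ) * inner 𝕜 (b i) z.1 -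
        (Real.sin (ν i * t) : ℝ) * inner 𝕜 (b i) z.2 := by
  rw [rotation_apply, inner_sub_right, cosDiagonal, sinDiagonal, inner_diagonal, inner_diagonal]

lemma inner_rotation_snd (t : ℝ) (z : H × H) (i : ι) :
    inner 𝕜 (b i) (rotation b ν t z).2 =
      (Real.sin (ν i * t) : ℝ) * inner 𝕜 (b i) z.1 +
        (Real.cos (ν i * t) : ℝ) * inner 𝕜 (b i) z.2 := by
  rw [rotation_apply, inner_add_right, cosDiagonal, sinDiagonal, inner_diagonal, inner_diagonal]

lemma rotation_zero (z : H × H) : rotation b ν 0 z = z :=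
  Prod.ext
    (ext_inner_basis b fun i => by
      rw [inner_rotation_fst, mul_zero, Real.cos_zero, Real.sin_zero, RCLike.ofReal_one,
        RCLike.ofReal_zero, one_mul, zero_mul, sub_zero])
    (ext_inner_basis b fun i => by
      rw [inner_rotation_snd, mul_zero, Real.cos_zero, Real.sin_zero, RCLike.ofReal_one,
        RCLike.ofReal_zero, one_mul, zero_mul, zero_add])

lemma inner_rotation (t : ℝ) (z z' : H × H) :
    inner 𝕜 (rotation b ν t z).1 (rotation b ν t z').1 +
        inner 𝕜 (rotation b ν t z).2 (rotation b ν t z').2 =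
      inner 𝕜 z.1 z'.1 + inner 𝕜 z.2 z'.2 := by
  refine ((b.hasSum_inner_mul_inner _ _).add (b.hasSum_inner_mul_inner _ _)).unique ?_
  convert (b.hasSum_inner_mul_inner z.1 z'.1).add (b.hasSum_inner_mul_inner z.2 z'.2) using 2
    with i
  have htrig : ((Real.cos (ν i * t) : ℝ) : 𝕜) ^ 2 + ((Real.sin (ν i * t) : ℝ) : 𝕜) ^ 2 = 1 :=
    mod_cast congr_arg ((↑) : ℝ → 𝕜) (Real.cos_sq_add_sin_sq (ν i * t))
  simp only [← inner_conj_symm _ (b i), inner_rotation_fst, inner_rotation_snd, map_add, map_sub,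
    map_mul, RCLike.conj_ofReal]
  linear_combination (starRingEnd 𝕜 (inner 𝕜 (b i) z.1) * inner 𝕜 (b i) z'.1 +
    starRingEnd 𝕜 (inner 𝕜 (b i) z.2) * inner 𝕜 (b i) z'.2) * htrig

lemma norm_rotation_le (t : ℝ) : ‖rotation b ν t‖ ≤ 2 := by
  have hcos (x : H) : ‖cosDiagonal b ν t x‖ ≤ 1 * ‖x‖ := norm_diagonal_apply_le b _ zero_le_one x
  have hsin (x : H) : ‖sinDiagonal b ν t x‖ ≤ 1 * ‖x‖ := norm_diagonal_apply_le b _ zero_le_one x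
  refine ContinuousLinearMap.opNorm_le_bound _ zero_le_two fun z => ?_
  rw [rotation_apply]
  refine norm_prod_le_iff.2 ⟨(norm_sub_le _ _).trans ?_, (norm_add_le _ _).trans ?_⟩
  · linarith [hcos z.1, hsin z.2, norm_fst_le z, norm_snd_le z]
  · linarith [hsin z.1, hcos z.2, norm_fst_le z, norm_snd_le z]

lemma continuous_cosDiagonal : Continuous fun z : ℝ × H => cosDiagonal b ν z.1 z.2 :=
  continuous_diagonal b (fun (t : ℝ) i => norm_ofReal_cos_le (ν i * t)) zero_le_one
    fun _ => RCLike.continuous_ofReal.comp (by fun_prop)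

lemma continuous_sinDiagonal : Continuous fun z : ℝ × H => sinDiagonal b ν z.1 z.2 :=
  continuous_diagonal b (fun (t : ℝ) i => norm_ofReal_sin_le (ν i * t)) zero_le_one
    fun _ => RCLike.continuous_ofReal.comp (by fun_prop)

lemma continuous_rotation : Continuous fun z : ℝ × (H × H) => rotation b ν z.1 z.2 := by
  have hcos_fst : Continuous fun z : ℝ × (H × H) => cosDiagonal b ν z.1 z.2.1 :=
    (continuous_cosDiagonal b ν).comp (f := fun z : ℝ × (H × H) => (z.1, z.2.1)) (by fun_prop)
  have hcos_snd : Continuous fun z : ℝ × (H × H) => cosDiagonal b ν z.1 z.2.2 :=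
    (continuous_cosDiagonal b ν).comp (f := fun z : ℝ × (H × H) => (z.1, z.2.2)) (by fun_prop)
  have hsin_fst : Continuous fun z : ℝ × (H × H) => sinDiagonal b ν z.1 z.2.1 :=
    (continuous_sinDiagonal b ν).comp (f := fun z : ℝ × (H × H) => (z.1, z.2.1)) (by fun_prop)
  have hsin_snd : Continuous fun z : ℝ × (H × H) => sinDiagonal b ν z.1 z.2.2 :=
    (continuous_sinDiagonal b ν).comp (f := fun z : ℝ × (H × H) => (z.1, z.2.2)) (by fun_prop)
  exact (hcos_fst.sub hsin_snd).prodMk (hsin_fst.add hcos_snd)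

lemma continuousOn_rotation {z : ℝ → H × H} {s : Set ℝ} (hz : ContinuousOn z s) :
    ContinuousOn (fun t => rotation b ν t (z t)) s :=
  (continuous_rotation b ν).comp_continuousOn (f := fun t => (t, z t)) (continuousOn_id.prodMk hz)

section Deriv

variable {b ν} {p r : ℝ → H} {s : Set ℝ} {t : ℝ} {i : ι} {p' r' : 𝕜}

lemma hasDerivAt_ofReal_cos_mul (c t : ℝ) :
    HasDerivAt (fun t : ℝ => ((Real.cos (c * t) : ℝ) : 𝕜)) (-(c * (Real.sin (c * t) : ℝ))) t := by
  have h := RCLike.ofRealCLM (K := 𝕜) |>.hasFDerivAt.comp_hasDerivAt t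
    ((hasDerivAt_id t).const_mul c).cos
  refine h.congr_deriv ?_
  rw [RCLike.ofRealCLM_apply]
  push_cast
  simp only [id_eq]
  ring

lemma hasDerivAt_ofReal_sin_mul (c t : ℝ) :
    HasDerivAt (fun t : ℝ => ((Real.sin (c * t) : ℝ) : 𝕜)) (c * (Real.cos (c * t) : ℝ)) t := by
  have h := RCLike.ofRealCLM (K := 𝕜) |>.hasFDerivAt.comp_hasDerivAt t
    ((hasDerivAt_id t).const_mul c).sin
  refine h.congr_deriv ?_
  rw [RCLike.ofRealCLM_apply]
  push_cast
  simp only [id_eq]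
  ring

lemma hasDerivWithinAt_inner_rotation_fst
    (hp : HasDerivWithinAt (fun t => inner 𝕜 (b i) (p t)) p' s t)
    (hr : HasDerivWithinAt (fun t => inner 𝕜 (b i) (r t)) r' s t) :
    HasDerivWithinAt (fun t => inner 𝕜 (b i) (rotation b ν t (p t, r t)).1)
      ((Real.cos (ν i * t) : ℝ) * (p' - ν i * inner 𝕜 (b i) (r t)) -
        (Real.sin (ν i * t) : ℝ) * (r' + ν i * inner 𝕜 (b i) (p t))) s t := by
  simp only [inner_rotation_fst]
  refine (((hasDerivAt_ofReal_cos_mul (ν i) t).hasDerivWithinAt.mul hp).sub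
    ((hasDerivAt_ofReal_sin_mul (ν i) t).hasDerivWithinAt.mul hr)).congr_deriv ?_
  ring

lemma hasDerivWithinAt_inner_rotation_snd
    (hp : HasDerivWithinAt (fun t => inner 𝕜 (b i) (p t)) p' s t)
    (hr : HasDerivWithinAt (fun t => inner 𝕜 (b i) (r t)) r' s t) :
    HasDerivWithinAt (fun t => inner 𝕜 (b i) (rotation b ν t (p t, r t)).2)
      ((Real.sin (ν i * t) : ℝ) * (p' - ν i * inner 𝕜 (b i) (r t)) +
        (Real.cos (ν i * t) : ℝ) * (r' + ν i * inner 𝕜 (b i) (p t))) s t := by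
  simp only [inner_rotation_snd]
  refine (((hasDerivAt_ofReal_sin_mul (ν i) t).hasDerivWithinAt.mul hp).add
    ((hasDerivAt_ofReal_cos_mul (ν i) t).hasDerivWithinAt.mul hr)).congr_deriv ?_
  ring

end Deriv

end Rotation

section Oscillator

variable {𝕜 ι H : Type*} [RCLike 𝕜] [NormedAddCommGroup H] [InnerProductSpace 𝕜 H]
  [NormedSpace ℝ H] {b : HilbertBasis ι 𝕜 H} {ν : ι → ℝ} {T : ℝ} {p r F : ℝ → H}

/-- The system `p' = ν r`, `r' = -ν p + F` on `[0,T]` with continuous data, coordinate by coordinate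
in the basis `b`. The multiplier `ν` may be unbounded, so that `p` and `r` need not be
differentiable as curves in `H`. -/
structure IsOscillator (b : HilbertBasis ι 𝕜 H) (ν : ι → ℝ) (T : ℝ) (p r F : ℝ → H) : Prop where
  cont_fst : ContinuousOn p (Icc 0 T)
  cont_snd : ContinuousOn r (Icc 0 T)
  cont_force : ContinuousOn F (Icc 0 T)
  deriv_fst : ∀ i, ∀ t ∈ Icc 0 T, HasDerivWithinAt (fun t => inner 𝕜 (b i) (p t))
    (ν i * inner 𝕜 (b i) (r t)) (Icc 0 T) t
  deriv_snd : ∀ i, ∀ t ∈ Icc 0 T, HasDerivWithinAt (fun t => inner 𝕜 (b i) (r t))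
    (-(ν i * inner 𝕜 (b i) (p t)) + inner 𝕜 (b i) (F t)) (Icc 0 T) t

lemma hasDerivWithinAt_inner_right (v : H) {f : ℝ → H} {f' : H} {s : Set ℝ} {t : ℝ}
    (hf : HasDerivWithinAt f f' s t) :
    HasDerivWithinAt (fun t => inner 𝕜 v (f t)) (inner 𝕜 v f') s t := by
  simpa only [inner_zero_left, add_zero] using (hasDerivWithinAt_const t s v).inner 𝕜 hf

lemma hasDerivWithinAt_re_inner {f g : ℝ → H} {f' g' : H} {s : Set ℝ} {t : ℝ}
    (hf : HasDerivWithinAt f f' s t) (hg : HasDerivWithinAt g g' s t) :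
    HasDerivWithinAt (fun t => RCLike.re (inner 𝕜 (f t) (g t)))
      (RCLike.re (inner 𝕜 (f t) g') + RCLike.re (inner 𝕜 f' (g t))) s t := by
  rw [← map_add]
  exact (RCLike.reCLM (K := 𝕜)).hasFDerivAt.comp_hasDerivWithinAt t (hf.inner 𝕜 hg)

lemma isOscillator_rotation_neg {y : ℝ → H × H} (hF : ContinuousOn F (Icc 0 T))
    (hy : ∀ t ∈ Icc 0 T, HasDerivWithinAt y (rotation b ν t (0, F t)) (Icc 0 T) t) :
    IsOscillator b ν T (fun t => (rotation b (-ν) t (y t)).1)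
      (fun t => (rotation b (-ν) t (y t)).2) F := by
  have hcont : ContinuousOn (fun t => rotation b (-ν) t (y t)) (Icc 0 T) :=
    continuousOn_rotation b (-ν) fun t ht => (hy t ht).continuousWithinAt
  have hfst (i : ι) {t : ℝ} (ht : t ∈ Icc 0 T) : HasDerivWithinAt
      (fun t => inner 𝕜 (b i) (y t).1) (inner 𝕜 (b i) (rotation b ν t (0, F t)).1) (Icc 0 T) t :=
    hasDerivWithinAt_inner_right (b i)
      ((ContinuousLinearMap.fst ℝ H H).hasFDerivAt.comp_hasDerivWithinAt t (hy t ht))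
  have hsnd (i : ι) {t : ℝ} (ht : t ∈ Icc 0 T) : HasDerivWithinAt
      (fun t => inner 𝕜 (b i) (y t).2) (inner 𝕜 (b i) (rotation b ν t (0, F t)).2) (Icc 0 T) t :=
    hasDerivWithinAt_inner_right (b i)
      ((ContinuousLinearMap.snd ℝ H H).hasFDerivAt.comp_hasDerivWithinAt t (hy t ht))
  have htrig (i : ι) (t : ℝ) :
      ((Real.cos (ν i * t) : ℝ) : 𝕜) ^ 2 + ((Real.sin (ν i * t) : ℝ) : 𝕜) ^ 2 = 1 :=
    mod_cast congr_arg ((↑) : ℝ → 𝕜) (Real.cos_sq_add_sin_sq (ν i * t))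
  refine ⟨hcont.fst, hcont.snd, hF, fun i t ht => ?_, fun i t ht => ?_⟩
  · refine (hasDerivWithinAt_inner_rotation_fst (hfst i ht) (hsnd i ht)).congr_deriv ?_
    simp only [inner_rotation_fst, inner_rotation_snd, inner_zero_right, Pi.neg_apply, neg_mul,
      Real.cos_neg, Real.sin_neg, map_neg]
    ring
  · refine (hasDerivWithinAt_inner_rotation_snd (hfst i ht) (hsnd i ht)).congr_deriv ?_
    simp only [inner_rotation_fst, inner_rotation_snd, inner_zero_right, Pi.neg_apply, neg_mul,
      Real.cos_neg, Real.sin_neg, map_neg]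
    linear_combination inner 𝕜 (b i) (F t) * htrig i t

variable [CompleteSpace H]

lemma IsOscillator.hasDerivWithinAt_rotation (h : IsOscillator b ν T p r F) (hT : 0 ≤ T) {t : ℝ}
    (ht : t ∈ Icc 0 T) :
    HasDerivWithinAt (fun t => (rotation b ν t (p t, r t)).1) (rotation b ν t (0, F t)).1
        (Icc 0 T) t ∧
      HasDerivWithinAt (fun t => (rotation b ν t (p t, r t)).2) (rotation b ν t (0, F t)).2
        (Icc 0 T) t := by
  have hcont : ContinuousOn (fun t => rotation b ν t (0, F t)) (Icc 0 T) :=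
    continuousOn_rotation b ν (continuousOn_const.prodMk h.cont_force)
  refine ⟨hasDerivWithinAt_of_inner_basis b hT hcont.fst (fun i t ht => ?_) ht,
    hasDerivWithinAt_of_inner_basis b hT hcont.snd (fun i t ht => ?_) ht⟩
  · refine (hasDerivWithinAt_inner_rotation_fst (h.deriv_fst i t ht)
      (h.deriv_snd i t ht)).congr_deriv ?_
    rw [inner_rotation_fst, inner_zero_right]
    ring
  · refine (hasDerivWithinAt_inner_rotation_snd (h.deriv_fst i t ht)
      (h.deriv_snd i t ht)).congr_deriv ?_
    rw [inner_rotation_snd, inner_zero_right]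
    ring

-- In the rotating frame the unbounded multiplier `ν` disappears, and the curves are differentiable.
lemma IsOscillator.hasDerivWithinAt_energy (h : IsOscillator b ν T p r F) (hT : 0 ≤ T) {t : ℝ}
    (ht : t ∈ Icc 0 T) :
    HasDerivWithinAt (fun t => ‖p t‖ ^ 2 + ‖r t‖ ^ 2) (2 * RCLike.re (inner 𝕜 (r t) (F t)))
      (Icc 0 T) t := by
  obtain ⟨hfst, hsnd⟩ := h.hasDerivWithinAt_rotation hT ht
  have henergy (t : ℝ) : ‖p t‖ ^ 2 + ‖r t‖ ^ 2 =
      RCLike.re (inner 𝕜 (rotation b ν t (p t, r t)).1 (rotation b ν t (p t, r t)).1) +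
        RCLike.re (inner 𝕜 (rotation b ν t (p t, r t)).2 (rotation b ν t (p t, r t)).2) := by
    rw [← map_add, inner_rotation, map_add, inner_self_eq_norm_sq, inner_self_eq_norm_sq]
  have hforce := congr_arg RCLike.re (inner_rotation b ν t (p t, r t) (0, F t))
  rw [inner_zero_right, zero_add, map_add] at hforce
  simp_rw [henergy]
  refine ((hasDerivWithinAt_re_inner hfst hfst).add
    (hasDerivWithinAt_re_inner hsnd hsnd)).congr_deriv ?_
  rw [← hforce, inner_re_symm _ (rotation b ν t (p t, r t)).1,
    inner_re_symm _ (rotation b ν t (p t, r t)).2]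
  ring

theorem exists_isOscillator (b : HilbertBasis ι 𝕜 H) (ν : ι → ℝ) (hT : 0 ≤ T)
    (N : H × H →L[𝕜] H) (p₀ r₀ : H) :
    ∃ p r : ℝ → H, IsOscillator b ν T p r (fun t => N (p t, r t)) ∧ p 0 = p₀ ∧ r 0 = r₀ := by
  let A (t : ℝ) : H × H →L[𝕜] H × H :=
    rotation b ν t ∘L .inr 𝕜 H H ∘L N ∘L rotation b (-ν) t
  have hA : Continuous fun z : ℝ × (H × H) => A z.1 z.2 :=
    (continuous_rotation b ν).comp
      (f := fun z : ℝ × (H × H) => (z.1, ((0 : H), N (rotation b (-ν) z.1 z.2))))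
      (continuous_fst.prodMk (continuous_const.prodMk
        (N.continuous.comp (continuous_rotation b (-ν)))))
  have hA_lipschitz (t : ℝ) : LipschitzWith (2 * (1 * (‖N‖₊ * 2))) (A t) := by
    have hrot (ν : ι → ℝ) : LipschitzWith 2 (rotation b ν t) :=
      (rotation b ν t).lipschitz.weaken (norm_rotation_le b ν t)
    exact (hrot ν).comp (LipschitzWith.prodMk_left 0 |>.comp (N.lipschitz.comp (hrot (-ν))))
  obtain ⟨y, hy₀, hy⟩ := exists_solution_of_lipschitz hT hA hA_lipschitz (p₀, r₀)
  have hF : ContinuousOn (fun t => N (rotation b (-ν) t (y t))) (Icc 0 T) :=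
    N.continuous.comp_continuousOn <|
      continuousOn_rotation b (-ν) fun t ht => (hy t ht).continuousWithinAt
  refine ⟨_, _, isOscillator_rotation_neg hF hy, ?_, ?_⟩
  · rw [rotation_zero, hy₀]
  · rw [rotation_zero, hy₀]

end Oscillator

/-! ### The square root of the shifted operator -/

lemma ofReal_sqrt_mul_self {x : ℝ} (hx : 0 ≤ x) : ((√x : ℝ) : ℂ) * (√x : ℝ) = x := by
  rw [← Complex.ofReal_mul, Real.mul_self_sqrt hx]

lemma norm_cpow_half_le {x y : ℝ} (h : |x| ≤ y) : ‖(x : ℂ) ^ ((1 / 2 : ℝ) : ℂ)‖ ≤ √y := by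
  rw [Complex.norm_cpow_real, Complex.norm_real, ← Real.sqrt_eq_rpow]
  exact Real.sqrt_le_sqrt h

/-- A constant `M ≥ 0` such that `1 ≤ x + M` and `|x| ≤ x + M` for all `x ≥ m`. It is added to an
operator with spectrum bounded below by `m`. -/
noncomputable def shift (m : ℝ) : ℝ := 2 * |m| + 1

lemma shift_nonneg (m : ℝ) : 0 ≤ shift m := by
  rw [shift]
  positivity

lemma one_le_add_shift {m x : ℝ} (h : m ≤ x) : 1 ≤ x + shift m := by
  rw [shift]
  linarith [neg_abs_le m, abs_nonneg m]

lemma abs_le_add_shift {m x : ℝ} (h : m ≤ x) : |x| ≤ x + shift m := by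
  rw [shift]
  exact abs_le.2 ⟨by linarith [neg_abs_le m], by linarith [abs_nonneg m]⟩

section SqrtShift

variable {ι H : Type*} [NormedAddCommGroup H] [InnerProductSpace ℂ H] {b : HilbertBasis ι ℂ H}
  {l : ι → ℝ} {M : ℝ} {u p : H}

/-- The graph of `(A + M)^{1/2}`, where `A` is the diagonal operator with eigenvalues `l` in the
basis `b`. Unlike `A^{1/2}`, which need not be positive, it controls the norm when `1 ≤ l + M`. -/
def IsSqrtShift (b : HilbertBasis ι ℂ H) (l : ι → ℝ) (M : ℝ) (u p : H) : Prop :=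
  ∀ i, inner ℂ (b i) p = (√(l i + M) : ℝ) * inner ℂ (b i) u

lemma IsSqrtShift.norm_le (h : IsSqrtShift b l M u p) (hM : ∀ i, 1 ≤ l i + M) : ‖u‖ ≤ ‖p‖ := by
  rw [← one_mul ‖p‖]
  refine norm_le_of_norm_inner_le b zero_le_one fun i => ?_
  rw [h i, norm_mul, one_mul, Complex.norm_real, Real.norm_of_nonneg (Real.sqrt_nonneg _)]
  exact le_mul_of_one_le_left (norm_nonneg _) (Real.one_le_sqrt.2 (hM i))

lemma norm_inv_sqrt_le_one {x : ℝ} (hx : 1 ≤ x) : ‖((√x : ℝ) : ℂ)⁻¹‖ ≤ 1 := by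
  rw [norm_inv, Complex.norm_real, Real.norm_of_nonneg (Real.sqrt_nonneg _)]
  exact inv_le_one_of_one_le₀ (Real.one_le_sqrt.2 hx)

lemma ofReal_sqrt_ne_zero {x : ℝ} (hx : 1 ≤ x) : ((√x : ℝ) : ℂ) ≠ 0 :=
  Complex.ofReal_ne_zero.2 (Real.sqrt_pos.2 (zero_lt_one.trans_le hx)).ne'

/-- The operator `(A + M)^{-1/2}`, where `A` is the diagonal operator with eigenvalues `l` in the
basis `b`. -/
noncomputable def invSqrtShift (b : HilbertBasis ι ℂ H) (hM : ∀ i, 1 ≤ l i + M) : H →L[ℂ] H :=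
  diagonal b fun i => norm_inv_sqrt_le_one (hM i)

lemma isSqrtShift_invSqrtShift (hM : ∀ i, 1 ≤ l i + M) (p : H) :
    IsSqrtShift b l M (invSqrtShift b hM p) p := fun i => by
  rw [invSqrtShift, inner_diagonal, mul_inv_cancel_left₀ (ofReal_sqrt_ne_zero (hM i))]

lemma IsSqrtShift.invSqrtShift_eq (h : IsSqrtShift b l M u p) (hM : ∀ i, 1 ≤ l i + M) :
    invSqrtShift b hM p = u :=
  ext_inner_basis b fun i => by
    rw [invSqrtShift, inner_diagonal, h i, inv_mul_cancel_left₀ (ofReal_sqrt_ne_zero (hM i))]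

end SqrtShift

section SturmLiouvilleSqrtShift

variable {ι : Type*} {q : LInf} {b : HilbertBasis ι ℂ L2} {l : ι → ℝ} {M : ℝ}

lemma IsSqrtShift.norm_sq {u p g : L2} (h : IsSqrtShift b l M u p) (hb : IsEigenbasis q l b)
    (hM : ∀ i, 0 ≤ l i + M) (hg : IsSturmLiouville q u g) :
    ‖p‖ ^ 2 = (inner ℂ u g).re + M * ‖u‖ ^ 2 := by
  have hcoord (i : ι) : inner ℂ p (b i) * inner ℂ (b i) p =
      inner ℂ u (b i) * inner ℂ (b i) g + M * (inner ℂ u (b i) * inner ℂ (b i) u) := by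
    have hsqrt := ofReal_sqrt_mul_self (hM i)
    push_cast at hsqrt
    rw [← inner_conj_symm p, h i, hb.inner_of_isSturmLiouville hg, map_mul, Complex.conj_ofReal,
      inner_conj_symm]
    linear_combination (inner ℂ u (b i) * inner ℂ (b i) u) * hsqrt
  have hsum := b.hasSum_inner_mul_inner p p
  simp_rw [hcoord] at hsum
  have hinner := hsum.unique ((b.hasSum_inner_mul_inner u g).add
    ((b.hasSum_inner_mul_inner u u).mul_left (M : ℂ)))
  have hself (f : L2) : (inner ℂ f f).re = ‖f‖ ^ 2 := inner_self_eq_norm_sq (𝕜 := ℂ) f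
  rw [← hself p, hinner, Complex.add_re, Complex.re_ofReal_mul, hself]

lemma IsSqrtShift.norm_le_of_isFractionalPower {u p w : L2} (h : IsSqrtShift b l M u p)
    (hb : IsEigenbasis q l b) (hM : ∀ i, |l i| ≤ l i + M)
    (hw : IsFractionalPower q (1 / 2) u w) : ‖w‖ ≤ ‖p‖ := by
  rw [← one_mul ‖p‖]
  refine norm_le_of_norm_inner_le b zero_le_one fun i => ?_
  rw [h i, hw _ _ (hb i), norm_mul, norm_mul, one_mul, Complex.norm_real,
    Real.norm_of_nonneg (Real.sqrt_nonneg _)]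
  gcongr
  exact norm_cpow_half_le (hM i)

lemma IsSqrtShift.vanishesAtEndpoints {u p : L2} (h : IsSqrtShift b l M u p)
    (hb : IsEigenbasis q l b) (hM : ∀ i, |l i| ≤ l i + M) : VanishesAtEndpoints u := by
  refine hb.vanishesAtEndpoints ((hasSum_norm_inner_sq b p).summable.of_nonneg_of_le
    (fun i => by positivity) fun i => ?_)
  rw [h i, norm_mul, mul_pow, Complex.norm_real, Real.norm_of_nonneg (Real.sqrt_nonneg _),
    Real.sq_sqrt ((abs_nonneg _).trans (hM i))]
  gcongr
  exact hM i

lemma IsSturmLiouville.isSqrtShift {u g : L2} (hg : IsSturmLiouville q u g)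
    (hb : IsEigenbasis q l b) (hM : ∀ i, 1 ≤ l i + M) :
    IsSqrtShift b l M u (invSqrtShift b hM (g + (M : ℂ) • u)) := fun i => by
  have hsqrt := ofReal_sqrt_mul_self (zero_le_one.trans (hM i))
  push_cast at hsqrt
  rw [invSqrtShift, inner_diagonal, inner_add_right, inner_smul_right,
    hb.inner_of_isSturmLiouville hg, ← add_mul, ← hsqrt, mul_assoc,
    inv_mul_cancel_left₀ (ofReal_sqrt_ne_zero (hM i))]

lemma IsSturmLiouville.inner_add_smul_invSqrtShift {ψ Lψ : L2} (hψ : IsSturmLiouville q ψ Lψ)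
    (hb : IsEigenbasis q l b) (hM : ∀ i, 1 ≤ l i + M) (x : L2) :
    inner ℂ (Lψ + (M : ℂ) • ψ) (invSqrtShift b hM (invSqrtShift b hM x)) = inner ℂ ψ x := by
  rw [← b.tsum_inner_mul_inner, ← b.tsum_inner_mul_inner]
  refine tsum_congr fun i => ?_
  have hsqrt := ofReal_sqrt_mul_self (zero_le_one.trans (hM i))
  push_cast at hsqrt
  rw [← inner_conj_symm, inner_add_right, inner_smul_right, hb.inner_of_isSturmLiouville hψ,
    ← add_mul, ← hsqrt, invSqrtShift, inner_diagonal, inner_diagonal, map_mul, map_mul,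
    Complex.conj_ofReal, inner_conj_symm]
  have hne := ofReal_sqrt_ne_zero (hM i)
  field_simp

lemma exists_isFractionalPower_of_isSqrtShift (hb : IsEigenbasis q l b)
    (hM : ∀ i, 1 ≤ l i + M) (hM_abs : ∀ i, |l i| ≤ l i + M) :
    ∃ P : L2 →L[ℂ] L2, ∀ u p, IsSqrtShift b l M u p → IsFractionalPower q (1 / 2) u (P p) := by
  have hbound (i : ι) :
      ‖(l i : ℂ) ^ ((1 / 2 : ℝ) : ℂ) / ((√(l i + M) : ℝ) : ℂ)‖ ≤ 1 := by
    rw [norm_div, Complex.norm_real, Real.norm_of_nonneg (Real.sqrt_nonneg _)]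
    exact div_le_one_of_le₀ (norm_cpow_half_le (hM_abs i)) (Real.sqrt_nonneg _)
  refine ⟨diagonal b hbound, fun u p h => hb.isFractionalPower fun i => ?_⟩
  rw [inner_diagonal, h i, ← mul_assoc, div_mul_cancel₀ _ (ofReal_sqrt_ne_zero (hM i))]

-- `(l + M)^{1/2}` is a bounded multiple of `l^{1/2}` where `1 ≤ l`, and bounded where `l < 1`.
lemma exists_isSqrtShift_of_isFractionalPower (hb : IsEigenbasis q l b) (hM : 0 ≤ M) :
    ∃ A B : L2 →L[ℂ] L2, ∀ u w, IsFractionalPower q (1 / 2) u w →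
      IsSqrtShift b l M u (A w + B u) := by
  have hA (i : ι) :
      ‖if 1 ≤ l i then ((√(l i + M) / √(l i) : ℝ) : ℂ) else 0‖ ≤ √(1 + M) := by
    split_ifs with hi
    · rw [Complex.norm_real, Real.norm_of_nonneg (by positivity),
        ← Real.sqrt_div' _ (by linarith)]
      refine Real.sqrt_le_sqrt ((div_le_iff₀ (by linarith)).2 ?_)
      linarith [le_mul_of_one_le_right hM hi]
    · rw [norm_zero]
      exact Real.sqrt_nonneg _
  have hB (i : ι) : ‖if 1 ≤ l i then 0 else ((√(l i + M) : ℝ) : ℂ)‖ ≤ √(1 + M) := by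
    split_ifs with hi
    · rw [norm_zero]
      exact Real.sqrt_nonneg _
    · rw [Complex.norm_real, Real.norm_of_nonneg (Real.sqrt_nonneg _)]
      exact Real.sqrt_le_sqrt (by linarith)
  refine ⟨diagonal b hA, diagonal b hB, fun u w hw i => ?_⟩
  rw [inner_add_right, inner_diagonal, inner_diagonal, hw _ _ (hb i)]
  split_ifs with hi
  · have hsqrt : √(l i) ≠ 0 := (Real.sqrt_pos.2 (by linarith)).ne'
    rw [← Complex.ofReal_cpow (by linarith), ← Real.sqrt_eq_rpow, ← mul_assoc,
      ← Complex.ofReal_mul, div_mul_cancel₀ _ hsqrt, zero_mul, add_zero]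
  · rw [zero_mul, zero_add]

end SturmLiouvilleSqrtShift

/-! ### The wave equation -/

lemma hasDerivWithinAt_apply_comp {H : Type*} [NormedAddCommGroup H] [NormedSpace ℂ H]
    (A : H →L[ℂ] H) {f : ℝ → H} {f' : H} {s : Set ℝ} {t : ℝ} (hf : HasDerivWithinAt f f' s t) :
    HasDerivWithinAt (fun t => A (f t)) (A f') s t :=
  (A.restrictScalars ℝ).hasFDerivAt.comp_hasDerivWithinAt t hf

section

variable {T : ℝ} {q a β : LInf} {u₀ u₁ : L2} {u v : ℝ → L2}

lemma timeDeriv_eq {u' : L2} {t : ℝ} (h : HasDerivWithinAt u u' (Icc 0 T) t) (hT : 0 < T)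
    (ht : t ∈ Icc 0 T) : timeDeriv T u t = u' :=
  h.derivWithin (uniqueDiffOn_Icc hT t ht)

lemma timeDeriv_sub (hu : DifferentiableOn ℝ u (Icc 0 T)) (hv : DifferentiableOn ℝ v (Icc 0 T))
    (hT : 0 < T) {t : ℝ} (ht : t ∈ Icc 0 T) :
    timeDeriv T (fun t => u t - v t) t = timeDeriv T u t - timeDeriv T v t :=
  timeDeriv_eq ((hu t ht).hasDerivWithinAt.sub (hv t ht).hasDerivWithinAt) hT ht

lemma IsContinuousIntoSobolev.sub {s : ℝ} (hu : IsContinuousIntoSobolev T q s u)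
    (hv : IsContinuousIntoSobolev T q s v) : IsContinuousIntoSobolev T q s fun t => u t - v t := by
  obtain ⟨hu_cont, w, hw, hw_cont⟩ := hu
  obtain ⟨hv_cont, z, hz, hz_cont⟩ := hv
  refine ⟨hu_cont.sub hv_cont, fun t => w t - z t, fun t ht l φ hφ => ?_, hw_cont.sub hz_cont⟩
  rw [inner_sub_right, inner_sub_right, hw t ht l φ hφ, hz t ht l φ hφ, mul_sub]

lemma SatisfiesWaveEquation.sub (hu : SatisfiesWaveEquation T q a β u)
    (hv : SatisfiesWaveEquation T q a β v)
    (hsub : ∀ t ∈ Icc 0 T,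
      timeDeriv T (fun t => u t - v t) t = timeDeriv T u t - timeDeriv T v t) :
    SatisfiesWaveEquation T q a β fun t => u t - v t := by
  intro ψ Lψ hψ t ht
  have hinner (τ : ℝ) (hτ : τ ∈ Icc 0 T) : inner ℂ ψ (timeDeriv T (fun t => u t - v t) τ) =
      inner ℂ ψ (timeDeriv T u τ) - inner ℂ ψ (timeDeriv T v τ) := by
    rw [hsub τ hτ, inner_sub_right]
  refine (((hu ψ Lψ hψ t ht).sub (hv ψ Lψ hψ t ht)).congr hinner (hinner t ht)).congr_deriv ?_
  simp only [hsub t ht, ← mulL_apply, map_sub, inner_sub_right]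
  ring

namespace IsSolution

lemma hasDerivWithinAt (h : IsSolution T q a β u₀ u₁ u) {t : ℝ} (ht : t ∈ Icc 0 T) :
    HasDerivWithinAt u (timeDeriv T u t) (Icc 0 T) t :=
  (h.contDiff.differentiableOn one_ne_zero t ht).hasDerivWithinAt

lemma continuousOn_timeDeriv (h : IsSolution T q a β u₀ u₁ u) (hT : 0 < T) :
    ContinuousOn (timeDeriv T u) (Icc 0 T) :=
  h.contDiff.continuousOn_derivWithin (uniqueDiffOn_Icc hT) le_rfl

lemma sub {v₀ v₁ : L2} (hu : IsSolution T q a β u₀ u₁ u) (hv : IsSolution T q a β v₀ v₁ v)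
    (hT : 0 < T) : IsSolution T q a β (u₀ - v₀) (u₁ - v₁) fun t => u t - v t := by
  have hsub (t : ℝ) (ht : t ∈ Icc 0 T) :=
    timeDeriv_sub (hu.contDiff.differentiableOn one_ne_zero)
      (hv.contDiff.differentiableOn one_ne_zero) hT ht
  exact
    { continuous_sobolev := hu.continuous_sobolev.sub hv.continuous_sobolev
      contDiff := hu.contDiff.sub hv.contDiff
      equation := hu.equation.sub hv.equation hsub
      initial := by rw [hu.initial, hv.initial]
      initial_deriv := by
        rw [hsub 0 (left_mem_Icc.2 hT.le), hu.initial_deriv, hv.initial_deriv]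
      boundary := fun t ht => (hu.boundary t ht).sub (hv.boundary t ht) }

end IsSolution

end

section Energy

variable {ι : Type*} {b : HilbertBasis ι ℂ L2} {l : ι → ℝ} {M T : ℝ} {q a β : LInf} {u₀ u₁ : L2}
  {u p : ℝ → L2}

/-- The right-hand side of `u_tt + (𝓛 + M) u = M u - a u - β u_t`, as a function of `u` and
`r = u_t`. -/
noncomputable def dampedForce (M : ℝ) (a β : LInf) (u r : L2) : L2 :=
  (M : ℂ) • u - mulL a u - mulL β r

/-- The energy of the wave equation at time `t`; here `p` stands for `(𝓛 + M)^{1/2} u`. -/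
noncomputable def waveEnergy (T : ℝ) (a : LInf) (u p : ℝ → L2) (t : ℝ) : ℝ :=
  ‖p t‖ ^ 2 + ‖timeDeriv T u t‖ ^ 2 + (inner ℂ (u t) (mulL a (u t))).re

lemma continuousOn_dampedForce {s : Set ℝ} {r : ℝ → L2} (hu : ContinuousOn u s)
    (hr : ContinuousOn r s) : ContinuousOn (fun t => dampedForce M a β (u t) (r t)) s :=
  ((hu.const_smul (M : ℂ)).sub ((mulL a).continuous.comp_continuousOn hu)).sub
    ((mulL β).continuous.comp_continuousOn hr)

lemma IsSolution.exists_isOscillator (h : IsSolution T q a β u₀ u₁ u) (hb : IsEigenbasis q l b)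
    (hM₀ : 0 ≤ M) (hM : ∀ i, 0 ≤ l i + M) (hT : 0 < T) :
    ∃ p : ℝ → L2, (∀ t ∈ Icc 0 T, IsSqrtShift b l M (u t) (p t)) ∧
      IsOscillator b (fun i => √(l i + M)) T p (timeDeriv T u)
        (fun t => dampedForce M a β (u t) (timeDeriv T u t)) := by
  obtain ⟨hu, w, hw, hw_cont⟩ := h.continuous_sobolev
  obtain ⟨A, B, hAB⟩ := exists_isSqrtShift_of_isFractionalPower hb hM₀
  have hp (t : ℝ) (ht : t ∈ Icc 0 T) : IsSqrtShift b l M (u t) (A (w t) + B (u t)) :=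
    hAB _ _ (hw t ht)
  have hr := h.continuousOn_timeDeriv hT
  refine ⟨_, hp, (A.continuous.comp_continuousOn hw_cont).add (B.continuous.comp_continuousOn hu),
    hr, continuousOn_dampedForce hu hr, fun i t ht => ?_, fun i t ht => ?_⟩
  · exact ((hasDerivWithinAt_inner_right (b i) (h.hasDerivWithinAt ht)).const_mul _).congr
      (fun t ht => hp t ht i) (hp t ht i)
  · refine (h.equation _ _ (hb i).2 t ht).congr_deriv ?_
    have hsqrt := ofReal_sqrt_mul_self (hM i)
    push_cast at hsqrt
    rw [hp t ht i, dampedForce]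
    simp only [RCLike.ofReal_eq_complex_ofReal, inner_sub_right, inner_smul_right,
      inner_smul_left, mulL_apply, Complex.conj_ofReal]
    linear_combination inner ℂ (b i) (u t) * hsqrt

lemma IsSolution.hasDerivWithinAt_waveEnergy (h : IsSolution T q a β u₀ u₁ u) {ν : ι → ℝ}
    (hp : IsOscillator b ν T p (timeDeriv T u)
      fun t => dampedForce M a β (u t) (timeDeriv T u t)) (hT : 0 ≤ T) {t : ℝ}
    (ht : t ∈ Icc 0 T) :
    HasDerivWithinAt (waveEnergy T a u p)
      (2 * (M * (inner ℂ (timeDeriv T u t) (u t)).re -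
        (inner ℂ (timeDeriv T u t) (mulL β (timeDeriv T u t))).re)) (Icc 0 T) t := by
  have hu := h.hasDerivWithinAt ht
  refine ((hp.hasDerivWithinAt_energy hT ht).add
    (hasDerivWithinAt_re_inner (𝕜 := ℂ) hu
      (hasDerivWithinAt_apply_comp (mulL a) hu))).congr_deriv ?_
  have hsymm : (inner ℂ (u t) (mulL a (timeDeriv T u t))).re =
      (inner ℂ (timeDeriv T u t) (mulL a (u t))).re := by
    rw [← inner_mulL_left, ← inner_conj_symm, Complex.conj_re]
  simp only [RCLike.re_eq_complex_re, dampedForce, inner_sub_right, inner_smul_right,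
    Complex.sub_re, Complex.re_ofReal_mul, hsymm]
  ring

lemma le_exp_mul_of_hasDerivWithinAt_le {G G' : ℝ → ℝ} {K : ℝ}
    (hG : ∀ t ∈ Icc 0 T, HasDerivWithinAt G (G' t) (Icc 0 T) t)
    (hG' : ∀ t ∈ Icc 0 T, G' t ≤ K * G t) {t : ℝ} (ht : t ∈ Icc 0 T) :
    G t ≤ G 0 * Real.exp (K * t) := by
  have hgronwall := le_gronwallBound_of_liminf_deriv_right_le (f' := G') (K := K) (ε := 0)
    (fun t ht => (hG t ht).continuousWithinAt)
    (fun s hs r hr => ((hG s (Ico_subset_Icc_self hs)).mono_of_mem_nhdsWithin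
      (Icc_mem_nhdsGE_of_mem hs)).liminf_right_slope_le hr) le_rfl
    (fun s hs => by rw [add_zero]; exact hG' s (Ico_subset_Icc_self hs)) t ht
  rwa [gronwallBound_ε0, sub_zero] at hgronwall

theorem IsSolution.exists_waveEnergy_le (h : IsSolution T q a β u₀ u₁ u)
    (hb : IsEigenbasis q l b) (hM₀ : 0 ≤ M) (hM : ∀ i, 1 ≤ l i + M) (hT : 0 < T) (ha : 0 ≤ a)
    (hβ : 0 ≤ β) :
    ∃ p : ℝ → L2, (∀ t ∈ Icc 0 T, IsSqrtShift b l M (u t) (p t)) ∧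
      ∀ t ∈ Icc 0 T, waveEnergy T a u p t ≤ waveEnergy T a u p 0 * Real.exp (M * t) := by
  obtain ⟨p, hp, hosc⟩ := h.exists_isOscillator hb hM₀ (fun i => zero_le_one.trans (hM i)) hT
  refine ⟨p, hp, fun t ht => le_exp_mul_of_hasDerivWithinAt_le
    (fun s hs => h.hasDerivWithinAt_waveEnergy hosc hT.le hs) (fun s hs => ?_) ht⟩
  have hcross : 2 * (inner ℂ (timeDeriv T u s) (u s)).re ≤ waveEnergy T a u p s := by
    have hu_sq := pow_le_pow_left₀ (norm_nonneg _) ((hp s hs).norm_le hM) 2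
    have hre : (inner ℂ (timeDeriv T u s) (u s)).re ≤ ‖timeDeriv T u s‖ * ‖u s‖ :=
      (Complex.re_le_norm _).trans (norm_inner_le_norm _ _)
    have ha_nonneg := re_inner_mulL_nonneg ha (u s)
    rw [waveEnergy]
    linarith [two_mul_le_add_sq ‖timeDeriv T u s‖ ‖u s‖]
  linarith [mul_le_mul_of_nonneg_left hcross hM₀, re_inner_mulL_nonneg hβ (timeDeriv T u s)]

lemma norm_sq_le_waveEnergy (ha : 0 ≤ a) (t : ℝ) : ‖p t‖ ^ 2 ≤ waveEnergy T a u p t := by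
  rw [waveEnergy]
  linarith [sq_nonneg ‖timeDeriv T u t‖, re_inner_mulL_nonneg ha (u t)]

lemma norm_timeDeriv_sq_le_waveEnergy (ha : 0 ≤ a) (t : ℝ) :
    ‖timeDeriv T u t‖ ^ 2 ≤ waveEnergy T a u p t := by
  rw [waveEnergy]
  linarith [sq_nonneg ‖p t‖, re_inner_mulL_nonneg ha (u t)]

/-- The energy at time `0` in terms of the initial data; here `g₀` stands for `𝓛 u₀`. -/
noncomputable def initialEnergy (M : ℝ) (a : LInf) (u₀ g₀ u₁ : L2) : ℝ :=
  (inner ℂ u₀ g₀).re + M * ‖u₀‖ ^ 2 + ‖u₁‖ ^ 2 + (inner ℂ u₀ (mulL a u₀)).re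

lemma IsSolution.waveEnergy_zero (h : IsSolution T q a β u₀ u₁ u) (hb : IsEigenbasis q l b)
    (hM : ∀ i, 0 ≤ l i + M) (hp : IsSqrtShift b l M (u 0) (p 0)) {g₀ : L2}
    (hg₀ : IsSturmLiouville q u₀ g₀) : waveEnergy T a u p 0 = initialEnergy M a u₀ g₀ u₁ := by
  rw [h.initial] at hp
  rw [waveEnergy, initialEnergy, h.initial, h.initial_deriv, hp.norm_sq hb hM hg₀]

end Energy

section Estimate

variable {T m : ℝ} {q a β : LInf} {u₀ g₀ u₁ : L2} {u v : ℝ → L2}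

theorem IsSolution.norm_sq_le_initialEnergy (h : IsSolution T q a β u₀ u₁ u) (hT : 0 < T)
    (ha : 0 ≤ a) (hβ : 0 ≤ β) (hm : ∀ l φ, IsEigenpair q l φ → m ≤ l)
    (hg₀ : IsSturmLiouville q u₀ g₀) {t : ℝ} (ht : t ∈ Icc 0 T) {w : L2}
    (hw : IsFractionalPower q (1 / 2) (u t) w) {x : L2}
    (hx : x ∈ ({u t, w, timeDeriv T u t} : Set L2)) :
    ‖x‖ ^ 2 ≤ initialEnergy (shift m) a u₀ g₀ u₁ * Real.exp (shift m * t) := by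
  obtain ⟨s, b, l, hb⟩ := exists_isEigenbasis q
  have hM_one (i : s) : 1 ≤ l i + shift m := one_le_add_shift (hm _ _ (hb i))
  have hM_abs (i : s) : |l i| ≤ l i + shift m := abs_le_add_shift (hm _ _ (hb i))
  obtain ⟨p, hp, henergy⟩ := h.exists_waveEnergy_le hb (shift_nonneg m) hM_one hT ha hβ
  have hE := henergy t ht
  rw [h.waveEnergy_zero hb (fun i => zero_le_one.trans (hM_one i)) (hp 0 (left_mem_Icc.2 hT.le))
    hg₀] at hE
  have hpt := (norm_sq_le_waveEnergy ha t).trans hE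
  rcases hx with rfl | rfl | rfl
  · exact (pow_le_pow_left₀ (norm_nonneg _) ((hp t ht).norm_le hM_one) 2).trans hpt
  · exact (pow_le_pow_left₀ (norm_nonneg _)
      ((hp t ht).norm_le_of_isFractionalPower hb hM_abs hw) 2).trans hpt
  · exact (norm_timeDeriv_sq_le_waveEnergy ha t).trans hE

theorem IsSolution.eqOn (hu : IsSolution T q a β u₀ u₁ u) (hv : IsSolution T q a β u₀ u₁ v)
    (hT : 0 < T) (ha : 0 ≤ a) (hβ : 0 ≤ β) : EqOn u v (Icc 0 T) := by
  have hd := hu.sub hv hT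
  rw [sub_self, sub_self] at hd
  obtain ⟨-, w, hw, -⟩ := hd.continuous_sobolev
  intro t ht
  have hle := hd.norm_sq_le_initialEnergy hT ha hβ (fun l φ h => h.neg_norm_le)
    (IsSturmLiouville.zero q) ht (hw t ht) (mem_insert _ _)
  rw [initialEnergy, map_zero, inner_zero_right, Complex.zero_re, norm_zero,
    zero_pow two_ne_zero, mul_zero, add_zero, add_zero, add_zero, zero_mul] at hle
  exact sub_eq_zero.1 (norm_eq_zero.1 (sq_eq_zero_iff.1 (hle.antisymm (sq_nonneg _))))

lemma initialEnergy_le {M : ℝ} (hM : 0 ≤ M) (q a : LInf) (u₀ u₀'' u₁ : L2) :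
    initialEnergy M a u₀ (-u₀'' + q • u₀) u₁ ≤
      (1 + M) * ((1 + ‖q‖) * (1 + ‖a‖)) * (‖u₀‖ + ‖u₀''‖ + ‖u₁‖) ^ 2 := by
  have hinner : (inner ℂ u₀ (-u₀'' + q • u₀)).re ≤ ‖u₀‖ * (‖u₀''‖ + ‖q‖ * ‖u₀‖) := by
    refine (Complex.re_le_norm _).trans ((norm_inner_le_norm _ _).trans ?_)
    gcongr
    exact (norm_add_le _ _).trans (add_le_add (norm_neg _).le (Lp.norm_smul_le q u₀))
  have ha : (inner ℂ u₀ (mulL a u₀)).re ≤ ‖a‖ * ‖u₀‖ ^ 2 :=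
    (le_abs_self _).trans (abs_re_inner_mulL_le a u₀)
  have hcoeff : 1 + (M + ‖q‖ + ‖a‖) ≤ (1 + M) * ((1 + ‖q‖) * (1 + ‖a‖)) := by
    have hnonneg : 0 ≤ ‖q‖ * ‖a‖ + M * (‖q‖ + ‖a‖ + ‖q‖ * ‖a‖) := by positivity
    linarith
  set N := ‖u₀‖ + ‖u₀''‖ + ‖u₁‖ with hN
  have hcross : ‖u₀‖ * ‖u₀''‖ + ‖u₁‖ ^ 2 ≤ N ^ 2 := by
    have hnonneg : 0 ≤ ‖u₀‖ ^ 2 + ‖u₀''‖ ^ 2 + ‖u₀‖ * ‖u₀''‖ + 2 * ‖u₀‖ * ‖u₁‖ +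
      2 * ‖u₀''‖ * ‖u₁‖ := by positivity
    rw [hN]
    linarith
  have hu₀ : ‖u₀‖ ^ 2 ≤ N ^ 2 := by
    gcongr
    linarith [norm_nonneg u₀'', norm_nonneg u₁]
  calc initialEnergy M a u₀ (-u₀'' + q • u₀) u₁
      ≤ (‖u₀‖ * ‖u₀''‖ + ‖u₁‖ ^ 2) + (M + ‖q‖ + ‖a‖) * ‖u₀‖ ^ 2 := by
        rw [initialEnergy]
        linarith
    _ ≤ N ^ 2 + (M + ‖q‖ + ‖a‖) * N ^ 2 := by gcongr
    _ = (1 + (M + ‖q‖ + ‖a‖)) * N ^ 2 := by ring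
    _ ≤ (1 + M) * ((1 + ‖q‖) * (1 + ‖a‖)) * N ^ 2 := by gcongr

theorem IsSolution.norm_le {u₀'' : L2} (h : IsSolution T q a β u₀ u₁ u) (hT : 0 < T)
    (ha : 0 ≤ a) (hβ : 0 ≤ β) (hm : ∀ l φ, IsEigenpair q l φ → m ≤ l)
    (h₀ : HasWeakSecondDeriv u₀ u₀'') (h₀' : VanishesAtEndpoints u₀) {t : ℝ} (ht : t ∈ Icc 0 T)
    {w : L2} (hw : IsFractionalPower q (1 / 2) (u t) w) {x : L2}
    (hx : x ∈ ({u t, w, timeDeriv T u t} : Set L2)) :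
    ‖x‖ ≤ Real.exp (shift m * T) * (1 + shift m) *
      ((1 + ‖q‖) * (1 + ‖a‖) * (1 + ‖β‖) * (‖u₀‖ + ‖u₀''‖ + ‖u₁‖)) := by
  have hM := shift_nonneg m
  have hsq := h.norm_sq_le_initialEnergy hT ha hβ hm ⟨h₀', u₀'', h₀, rfl⟩ ht hw hx
  set N := ‖u₀‖ + ‖u₀''‖ + ‖u₁‖
  set C := Real.exp (shift m * T) * (1 + shift m) with hC
  set K := (1 + ‖q‖) * (1 + ‖a‖)
  have hCK : 1 ≤ C * (K * (1 + ‖β‖)) := by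
    have hexp : 1 ≤ Real.exp (shift m * T) := Real.one_le_exp (by positivity)
    refine one_le_mul_of_one_le_of_one_le (one_le_mul_of_one_le_of_one_le hexp (by linarith))
      (one_le_mul_of_one_le_of_one_le (one_le_mul_of_one_le_of_one_le ?_ ?_) ?_) <;>
      exact le_add_of_nonneg_right (norm_nonneg _)
  refine le_of_sq_le_sq ?_ (by positivity)
  calc ‖x‖ ^ 2
      ≤ (1 + shift m) * K * N ^ 2 * Real.exp (shift m * t) :=
        hsq.trans (mul_le_mul_of_nonneg_right (initialEnergy_le hM q a u₀ u₀'' u₁)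
          (Real.exp_pos _).le)
    _ ≤ (1 + shift m) * K * N ^ 2 * Real.exp (shift m * T) := by
        gcongr
        exact ht.2
    _ = C * (K * 1) * N ^ 2 := by rw [hC]; ring
    _ ≤ C * (K * (1 + ‖β‖)) * N ^ 2 := by
        gcongr
        exact le_add_of_nonneg_right (norm_nonneg _)
    _ ≤ (C * (K * (1 + ‖β‖))) ^ 2 * N ^ 2 := by
        gcongr
        exact le_self_pow₀ hCK two_ne_zero
    _ = (C * (K * (1 + ‖β‖) * N)) ^ 2 := by ring

end Estimate

section Existence

variable {ι : Type*} {b : HilbertBasis ι ℂ L2} {l : ι → ℝ} {M T : ℝ} {q a β : LInf} {u₀ u₁ : L2}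
  {p r F : ℝ → L2}

lemma IsOscillator.hasDerivWithinAt_invSqrtShift
    (h : IsOscillator b (fun i => √(l i + M)) T p r F) (hM : ∀ i, 1 ≤ l i + M) (hT : 0 ≤ T)
    {t : ℝ} (ht : t ∈ Icc 0 T) :
    HasDerivWithinAt (fun t => invSqrtShift b hM (p t)) (r t) (Icc 0 T) t := by
  refine hasDerivWithinAt_of_inner_basis b hT h.cont_snd (fun i t ht => ?_) ht
  simp only [invSqrtShift, inner_diagonal]
  refine ((h.deriv_fst i t ht).const_mul _).congr_deriv ?_
  rw [RCLike.ofReal_eq_complex_ofReal, inv_mul_cancel_left₀ (ofReal_sqrt_ne_zero (hM i))]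

-- `r` is only weakly differentiable: its derivative involves `(A + M)^{1/2} p`.
lemma IsOscillator.hasDerivWithinAt_invSqrtShift_invSqrtShift
    (h : IsOscillator b (fun i => √(l i + M)) T p r F) (hM : ∀ i, 1 ≤ l i + M) (hT : 0 ≤ T)
    {t : ℝ} (ht : t ∈ Icc 0 T) :
    HasDerivWithinAt (fun t => invSqrtShift b hM (invSqrtShift b hM (r t)))
      (-invSqrtShift b hM (p t) + invSqrtShift b hM (invSqrtShift b hM (F t))) (Icc 0 T) t := by
  have hD := (invSqrtShift b hM).continuous
  have hcont : ContinuousOn (fun t => -invSqrtShift b hM (p t) +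
      invSqrtShift b hM (invSqrtShift b hM (F t))) (Icc 0 T) :=
    (hD.comp_continuousOn h.cont_fst).neg.add
      (hD.comp_continuousOn (hD.comp_continuousOn h.cont_force))
  refine hasDerivWithinAt_of_inner_basis b hT hcont (fun i t ht => ?_) ht
  simp only [invSqrtShift, inner_diagonal, inner_add_right, inner_neg_right]
  refine (((h.deriv_snd i t ht).const_mul _).const_mul _).congr_deriv ?_
  have hne := ofReal_sqrt_ne_zero (hM i)
  simp only [RCLike.ofReal_eq_complex_ofReal]
  field_simp

lemma IsOscillator.satisfiesWaveEquation (hb : IsEigenbasis q l b) (hM : ∀ i, 1 ≤ l i + M)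
    (h : IsOscillator b (fun i => √(l i + M)) T p r
      fun t => dampedForce M a β (invSqrtShift b hM (p t)) (r t))
    (hT : 0 < T) : SatisfiesWaveEquation T q a β fun t => invSqrtShift b hM (p t) := by
  intro ψ Lψ hψ t ht
  have hr (t : ℝ) (ht : t ∈ Icc 0 T) : timeDeriv T (fun t => invSqrtShift b hM (p t)) t = r t :=
    timeDeriv_eq (h.hasDerivWithinAt_invSqrtShift hM hT.le ht) hT ht
  have hinner (t : ℝ) (ht : t ∈ Icc 0 T) :
      inner ℂ ψ (timeDeriv T (fun t => invSqrtShift b hM (p t)) t) =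
        inner ℂ (Lψ + (M : ℂ) • ψ) (invSqrtShift b hM (invSqrtShift b hM (r t))) := by
    rw [hr t ht, hψ.inner_add_smul_invSqrtShift hb hM]
  refine ((hasDerivWithinAt_inner_right (Lψ + (M : ℂ) • ψ)
    (h.hasDerivWithinAt_invSqrtShift_invSqrtShift hM hT.le ht)).congr hinner
      (hinner t ht)).congr_deriv ?_
  rw [inner_add_right, hψ.inner_add_smul_invSqrtShift hb hM, hr t ht, dampedForce]
  simp only [inner_sub_right, inner_add_left, inner_smul_left, inner_smul_right, inner_neg_right,
    mulL_apply, Complex.conj_ofReal]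
  ring

lemma IsOscillator.isSolution (hb : IsEigenbasis q l b) (hM : ∀ i, 1 ≤ l i + M)
    (hM_abs : ∀ i, |l i| ≤ l i + M)
    (h : IsOscillator b (fun i => √(l i + M)) T p r
      fun t => dampedForce M a β (invSqrtShift b hM (p t)) (r t))
    (hT : 0 < T) (hp : IsSqrtShift b l M u₀ (p 0)) :
    IsSolution T q a β u₀ (r 0) fun t => invSqrtShift b hM (p t) := by
  have hu (t : ℝ) (ht : t ∈ Icc 0 T) := h.hasDerivWithinAt_invSqrtShift hM hT.le ht
  have hr (t : ℝ) (ht : t ∈ Icc 0 T) := timeDeriv_eq (hu t ht) hT ht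
  have hsqrt (t : ℝ) := isSqrtShift_invSqrtShift (b := b) hM (p t)
  obtain ⟨P, hP⟩ := exists_isFractionalPower_of_isSqrtShift hb hM hM_abs
  exact
    { continuous_sobolev := ⟨fun t ht => (hu t ht).continuousWithinAt, fun t => P (p t),
        fun t _ => hP _ _ (hsqrt t), P.continuous.comp_continuousOn h.cont_fst⟩
      contDiff := (contDiffOn_one_iff_derivWithin (uniqueDiffOn_Icc hT)).2
        ⟨fun t ht => (hu t ht).differentiableWithinAt, h.cont_snd.congr hr⟩
      equation := h.satisfiesWaveEquation hb hM hT
      initial := hp.invSqrtShift_eq hM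
      initial_deriv := hr 0 (left_mem_Icc.2 hT.le)
      boundary := fun t _ => (hsqrt t).vanishesAtEndpoints hb hM_abs }

theorem exists_isSolution (hT : 0 < T) (a β : LInf) {g₀ : L2} (hg₀ : IsSturmLiouville q u₀ g₀)
    (u₁ : L2) : ∃ u, IsSolution T q a β u₀ u₁ u := by
  obtain ⟨s, b, l, hb⟩ := exists_isEigenbasis q
  have hM (i : s) : 1 ≤ l i + shift (-‖q‖) := one_le_add_shift (hb i).neg_norm_le
  have hM_abs (i : s) : |l i| ≤ l i + shift (-‖q‖) := abs_le_add_shift (hb i).neg_norm_le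
  let N : L2 × L2 →L[ℂ] L2 :=
    ((shift (-‖q‖) : ℂ) • .id ℂ L2 - mulL a) ∘L invSqrtShift b hM ∘L .fst ℂ L2 L2 -
      mulL β ∘L .snd ℂ L2 L2
  obtain ⟨p, r, h, hp, rfl⟩ := exists_isOscillator b
    (fun i => √(l i + shift (-‖q‖))) hT.le N
    (invSqrtShift b hM (g₀ + (shift (-‖q‖) : ℂ) • u₀)) u₁
  exact ⟨_, h.isSolution hb hM hM_abs hT (hp ▸ hg₀.isSqrtShift hb hM)⟩

end Existence

end SturmLiouville

theorem mainTheorem3 (T : ℝ) (hT : 0 < T) :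
    (∀ (q a b : SturmLiouville.LInf) (u₀ u₀'' u₁ : SturmLiouville.L2),
      0 ≤ a → 0 ≤ b →
      SturmLiouville.HasWeakSecondDeriv u₀ u₀'' → SturmLiouville.VanishesAtEndpoints u₀ →
      ∃ u : ℝ → SturmLiouville.L2, SturmLiouville.IsSolution T q a b u₀ u₁ u ∧
        ∀ v : ℝ → SturmLiouville.L2, SturmLiouville.IsSolution T q a b u₀ u₁ v →
          Set.EqOn v u (Set.Icc 0 T)) ∧
    (∀ m : ℝ, ∃ C : ℝ, 0 < C ∧
      ∀ (q a b : SturmLiouville.LInf) (u₀ u₀'' u₁ : SturmLiouville.L2),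
        0 ≤ a → 0 ≤ b →
        SturmLiouville.HasWeakSecondDeriv u₀ u₀'' → SturmLiouville.VanishesAtEndpoints u₀ →
        (∀ (l : ℝ) (φ : SturmLiouville.L2), SturmLiouville.IsEigenpair q l φ → m ≤ l) →
        ∀ u : ℝ → SturmLiouville.L2, SturmLiouville.IsSolution T q a b u₀ u₁ u →
          ∀ t ∈ Set.Icc 0 T, ∀ w : SturmLiouville.L2,
            SturmLiouville.IsFractionalPower q (1 / 2) (u t) w →
            ‖u t‖ ≤ C * ((1 + ‖q‖) * (1 + ‖a‖) * (1 + ‖b‖) * (‖u₀‖ + ‖u₀''‖ + ‖u₁‖)) ∧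
            ‖w‖ ≤ C * ((1 + ‖q‖) * (1 + ‖a‖) * (1 + ‖b‖) * (‖u₀‖ + ‖u₀''‖ + ‖u₁‖)) ∧
            ‖SturmLiouville.timeDeriv T u t‖ ≤
              C * ((1 + ‖q‖) * (1 + ‖a‖) * (1 + ‖b‖) * (‖u₀‖ + ‖u₀''‖ + ‖u₁‖))) := by
  refine ⟨fun q a b u₀ u₀'' u₁ ha hb h₀ h₀' => ?_, fun m =>
    ⟨Real.exp (SturmLiouville.shift m * T) * (1 + SturmLiouville.shift m), ?_, ?_⟩⟩
  · obtain ⟨u, hu⟩ := SturmLiouville.exists_isSolution hT a b ⟨h₀', u₀'', h₀, rfl⟩ u₁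
    exact ⟨u, hu, fun v hv => hv.eqOn hu hT ha hb⟩
  · have hshift := SturmLiouville.shift_nonneg m
    positivity
  · intro q a b u₀ u₀'' u₁ ha hb h₀ h₀' hm u hu t ht w hw
    have hbound (x : SturmLiouville.L2) := hu.norm_le hT ha hb hm h₀ h₀' ht hw (x := x)
    exact ⟨hbound _ (.inl rfl), hbound _ (.inr (.inl rfl)), hbound _ (.inr (.inr rfl))⟩
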